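/- **Setting.** Let $d\in\mathbb N$, let $\mathfrak h$ be a finite-dimensional complex Hilbert space, let $V\subset\mathbb R^d$ be a discrete (i.e. locally finite) subgroup, and let $S\subset V$, $S\neq\{0\}$, be a set which generates $V$ as an additive monoid. A homogeneous open quantum random walk (OQRW) on $V$ is given by operators $L_s$, $s\in S$, on $\mathfrak h$ with $\sum_{s\in S}L_s^*L_s=\mathrm{Id}$. Its auxiliary map is $\mathfrak L(\rho)=\sum_{s\in S}L_s\rho L_s^*$ on the operators on $\mathfrak h$; it is *irreducible* if the only orthogonal projections $P$ with $\mathfrak L(P\,\mathcal B(\mathfrak h)\,P)\subset P\,\mathcal B(\mathfrak h)\,P$ are $0$ and $\mathrm{Id}$. For $u\in\mathbb R^d$ put $L^{(u)}_s=e^{\langle u,s\rangle/2}L_s$ and $\mathfrak L_u(\rho)=\sum_{s\in S}L^{(u)}_s\rho L^{(u)*}_s$, and let $\lambda_u$ be the spectral radius of $\mathfrak L_u$. We assume that these maps are defined, i.e. that $\sum_{s\in S}L^{(u)*}_sL^{(u)}_s$ converges for every $u\in\mathbb R^d$ (this is automatic when $S$ is finite). An initial state is a family $(\rho(i))_{i\in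 V}$ of positive operators on $\mathfrak h$ with $\sum_{i\in V}\mathrm{Tr}\,\rho(i)=1$ (it represents the state $\sum_i\rho(i)\otimes|i\rangle\langle i|$). The associated position process $(X_p)_{p\ge0}$ is the coordinate process on $V^{\mathbb N}$ under the unique probability measure $\mathbb P$ with $$\mathbb P(X_0=i_0,\dots,X_p=i_p)=\mathrm{Tr}\big(L_{s_p}\cdots L_{s_1}\,\rho(i_0)\,L_{s_1}^*\cdots L_{s_p}^*\big),\qquad s_k=i_k-i_{k-1},$$ if all $s_k$ belong to $S$, and $0$ otherwise. **Theorem.** Assume that $\mathfrak L$ is irreducible (it may be periodic), and let the initial state be arbitrary. Define $$I(x)=\sup_{u\in\mathbb R^d}\big(\langle u,x\rangle-\log\lambda_u\big),\qquad x\in\mathbb R^d.$$ Then $(\frac1p(X_p-X_0))_{p\ge1}$ satisfies a large deviation principle with good rate function $I$. Explicitly: $I$ takes values in $[0,+\infty]$, is lower semicontinuous and has compact level sets $\{x: I(x)\le\alpha\}$, $\alpha\in\mathbb R$; and for all open $G$ and closed $F$ with $G\subset F\subset\mathbb R^d$, $$-\inf_{x\in G}I(x)\le\liminf_{p\to\infty}\frac1p\log\mathbb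 P\Big(\frac{X_p-X_0}p\in G\Big)\le\limsup_{p\to\infty}\frac1p\log\mathbb P\Big(\frac{X_p-X_0}p\in F\Big)\le-\inf_{x\in F}I(x).$$ -/

import Mathlib

open MeasureTheory ProbabilityTheory Filter Topology
open scoped ENNReal InnerProductSpace

/-! ### Path measures on `ℕ → V` with prescribed cylinder probabilities -/

theorem pathMeasure_unique {V : Type*} [Countable V] [MeasurableSpace V]
    [MeasurableSingletonClass V] {P Q : Measure (ℕ → V)} [IsProbabilityMeasure P]
    (h : ∀ (n : ℕ) (x : ℕ → V), P {ω | ∀ k ≤ n, ω k = x k} = Q {ω | ∀ k ≤ n, ω k = x k}) :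
    P = Q := by
  have hfin : ∀ I : Finset ℕ, IsFiniteMeasure (P.map I.restrict) := fun I => by infer_instance
  have hP : IsProjectiveLimit P (fun I => P.map I.restrict) := fun I => rfl
  have hproj : IsProjectiveMeasureFamily (fun I : Finset ℕ => P.map I.restrict) := by
    intro I J hJI
    rw [Measure.map_map (Finset.measurable_restrict₂ _) (Finset.measurable_restrict _)]
    rfl
  refine hP.unique ((isProjectiveLimit_nat_iff hproj Q).2 fun n => ?_)
  refine Measure.ext_of_singleton fun y => ?_
  have hm : Measurable (Preorder.frestrictLe (π := fun _ : ℕ => V) n) :=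
    Preorder.measurable_frestrictLe n
  have hm' : Measurable (Finset.restrict (π := fun _ : ℕ => V) (Finset.Iic n)) :=
    Finset.measurable_restrict _
  rw [Measure.map_apply hm (measurableSet_singleton _),
    Measure.map_apply hm' (measurableSet_singleton _)]
  have hset : (Preorder.frestrictLe (π := fun _ : ℕ => V) n) ⁻¹' {y} =
      {ω | ∀ k ≤ n, ω k = y ⟨min k n, by simp⟩} := by
    ext ω
    simp only [Set.mem_preimage, Set.mem_singleton_iff, Set.mem_ofPred_eq]
    constructor
    · rintro rfl k hk
      simp [hk]
    · intro H
      ext ⟨k, hk⟩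
      have hk' := Finset.mem_Iic.1 hk
      have := H k hk'
      simp only [min_eq_left hk'] at this
      simpa using this
  have : (Finset.restrict (π := fun _ : ℕ => V) (Finset.Iic n)) ⁻¹' {y} =
    (Preorder.frestrictLe (π := fun _ : ℕ => V) n) ⁻¹' {y} := rfl
  rw [this, hset, h]

theorem weightMeasure_apply_singleton {V : Type*} [Countable V] [MeasurableSpace V]
    [MeasurableSingletonClass V] (g : V → ℝ≥0∞) (v : V) :
    (Measure.sum fun u => g u • Measure.dirac u) {v} = g v := by
  rw [Measure.sum_apply _ (measurableSet_singleton v), tsum_eq_single v]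
  · simp
  · intro u hu
    simp [hu]

theorem weightMeasure_univ {V : Type*} [Countable V] [MeasurableSpace V]
    [MeasurableSingletonClass V] (g : V → ℝ≥0∞) :
    (Measure.sum fun u => g u • Measure.dirac u) Set.univ = ∑' u, g u := by
  rw [Measure.sum_apply _ MeasurableSet.univ]
  simp

theorem exists_pathMeasure {V : Type*} [Nonempty V] [Countable V] [MeasurableSpace V]
    [MeasurableSingletonClass V] (w : ℕ → (ℕ → V) → ℝ≥0∞)
    (hdep : ∀ n x y, (∀ k ≤ n, x k = y k) → w n x = w n y)
    (h0 : ∀ x, ∑' v, w 0 (Function.update x 0 v) = 1)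
    (hs : ∀ n x, ∑' v, w (n + 1) (Function.update x (n + 1) v) = w n x) :
    ∃ P : Measure (ℕ → V), IsProbabilityMeasure P ∧
      ∀ n x, P {ω | ∀ k ≤ n, ω k = x k} = w n x := by
  classical
  obtain ⟨v₀⟩ := ‹Nonempty V›
  have hle : ∀ n x, w n x ≤ 1 := by
    intro n
    induction n with
    | zero =>
      intro x
      calc w 0 x = w 0 (Function.update x 0 (x 0)) := by simp
        _ ≤ _ := ENNReal.le_tsum (f := fun v => w 0 (Function.update x 0 v)) (x 0)
        _ = 1 := h0 x
    | succ n ih =>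
      intro x
      calc w (n + 1) x = w (n + 1) (Function.update x (n + 1) (x (n + 1))) := by simp
        _ ≤ _ := ENNReal.le_tsum (f := fun v => w (n + 1) (Function.update x (n + 1) v)) (x (n + 1))
        _ = w n x := hs n x
        _ ≤ 1 := ih x
  have htop : ∀ n x, w n x ≠ ∞ := fun n x => ((hle n x).trans_lt ENNReal.one_lt_top).ne
  let e : (n : ℕ) → ((i : Finset.Iic n) → V) → ℕ → V :=
    fun n y k => y ⟨min k n, by simp⟩
  let g : (n : ℕ) → ((i : Finset.Iic n) → V) → V → ℝ≥0∞ := fun n y v =>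
    if w n (e n y) = 0 then (if v = v₀ then 1 else 0)
    else (w n (e n y))⁻¹ * w (n + 1) (Function.update (e n y) (n + 1) v)
  have hg : ∀ n y, ∑' v, g n y v = 1 := by
    intro n y
    by_cases hw : w n (e n y) = 0
    · simp [g, hw]
    · simp only [g, hw, if_false]
      rw [ENNReal.tsum_mul_left, hs, ENNReal.inv_mul_cancel hw (htop _ _)]
  let κ : (n : ℕ) → Kernel ((i : Finset.Iic n) → V) V := fun n =>
    Kernel.ofFunOfCountable fun y => Measure.sum fun v => g n y v • Measure.dirac v
  have hκ : ∀ n, IsMarkovKernel (κ n) := fun n => ⟨fun y => ⟨by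
    change (Measure.sum fun v => g n y v • Measure.dirac v) Set.univ = 1
    rw [weightMeasure_univ, hg]⟩⟩
  let μ₀ : Measure V := Measure.sum fun v => w 0 (fun _ => v) • Measure.dirac v
  have hw0 : ∀ (x : ℕ → V) v, w 0 (Function.update x 0 v) = w 0 (fun _ => v) := fun x v =>
    hdep _ _ _ fun k hk => by
      obtain rfl : k = 0 := by omega
      simp
  have hμ₀ : IsProbabilityMeasure μ₀ := ⟨by
    change (Measure.sum fun v => w 0 (fun _ => v) • Measure.dirac v) Set.univ = 1
    rw [weightMeasure_univ, ← h0 fun _ => v₀]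
    exact tsum_congr fun v => (hw0 _ v).symm⟩
  let P : Measure (ℕ → V) := Kernel.trajMeasure (X := fun _ => V) μ₀ κ
  have hPp : IsProbabilityMeasure P := by
    change IsProbabilityMeasure (Kernel.trajMeasure (X := fun _ => V) μ₀ κ)
    infer_instance
  refine ⟨P, hPp, fun n => ?_⟩
  have hmeas : ∀ n (x : ℕ → V), MeasurableSet {ω : ℕ → V | ∀ k ≤ n, ω k = x k} := fun n x => by
    have : {ω : ℕ → V | ∀ k ≤ n, ω k = x k} = ⋂ k, ⋂ (_ : k ≤ n), (fun ω => ω k) ⁻¹' {x k} := by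
      ext; simp
    rw [this]
    exact MeasurableSet.iInter fun k => MeasurableSet.iInter fun _ =>
      measurable_pi_apply k (measurableSet_singleton _)
  induction n with
  | zero =>
    intro x
    have hz : P.map (Preorder.frestrictLe (π := fun _ : ℕ => V) 0) =
        μ₀.map (MeasurableEquiv.piUnique (fun _ : Finset.Iic 0 => V)).symm := by
      change (Kernel.trajMeasure (X := fun _ => V) μ₀ κ).map _ = _
      rw [Kernel.trajMeasure, Measure.map_comp _ _ (Preorder.measurable_frestrictLe 0),
        Kernel.traj_map_frestrictLe, Kernel.partialTraj_self, Measure.id_comp]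
    have key := congrArg (fun m => m {fun _ => x 0}) hz
    beta_reduce at key
    rw [Measure.map_apply (Preorder.measurable_frestrictLe 0) (measurableSet_singleton _),
      Measure.map_apply (MeasurableEquiv.measurable _) (measurableSet_singleton _)] at key
    have e1 : (Preorder.frestrictLe (π := fun _ : ℕ => V) 0) ⁻¹' {fun _ => x 0} =
        {ω | ∀ k ≤ 0, ω k = x k} := by
      ext ω
      simp only [Set.mem_preimage, Set.mem_singleton_iff, Set.mem_ofPred_eq]
      constructor
      · intro h k hk
        obtain rfl : k = 0 := by omega
        exact congrFun h ⟨0, by simp⟩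
      · intro h
        ext ⟨k, hk⟩
        obtain rfl : k = 0 := by simpa using hk
        exact h 0 le_rfl
    have e2 : (MeasurableEquiv.piUnique (fun _ : Finset.Iic 0 => V)).symm ⁻¹' {fun _ => x 0} =
        {x 0} := by
      ext v
      simp only [Set.mem_preimage, Set.mem_singleton_iff]
      constructor
      · intro h
        exact congrFun h ⟨0, by simp⟩
      · rintro rfl
        rfl
    rw [e1, e2] at key
    rw [key]
    have : μ₀ {x 0} = w 0 (fun _ => x 0) := weightMeasure_apply_singleton _ _
    rw [this, ← hw0 x (x 0), Function.update_eq_self]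
  | succ n ih =>
    intro x
    let r : Finset.Iic n → V := Preorder.frestrictLe (π := fun _ : ℕ => V) n x
    have hm : Measurable (Preorder.frestrictLe (π := fun _ : ℕ => V) n) :=
      Preorder.measurable_frestrictLe n
    have hpre : ∀ ω : ℕ → V, Preorder.frestrictLe (π := fun _ : ℕ => V) n ω = r ↔
        ∀ k ≤ n, ω k = x k := fun ω => by
      constructor
      · intro h k hk
        exact congrFun h ⟨k, by simpa using hk⟩
      · intro h
        ext ⟨k, hk⟩
        exact h k (by simpa using hk)
    have key := congrArg (fun m => m ({r} ×ˢ {x (n + 1)}))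
      (Kernel.map_frestrictLe_trajMeasure_compProd_eq_map_trajMeasure
        (X := fun _ => V) (μ₀ := μ₀) (κ := κ) (a := n))
    beta_reduce at key
    rw [Measure.map_apply (by fun_prop) ((measurableSet_singleton _).prod
      (measurableSet_singleton _)), Measure.compProd_apply_prod (measurableSet_singleton _)
      (measurableSet_singleton _), Measure.restrict_singleton, lintegral_smul_measure, 
      lintegral_dirac, Measure.map_apply hm (measurableSet_singleton _)] at key
    have e1 : (fun ω : ℕ → V => (Preorder.frestrictLe (π := fun _ : ℕ => V) n ω, ω (n + 1))) ⁻¹'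
        ({r} ×ˢ {x (n + 1)}) = {ω | ∀ k ≤ n + 1, ω k = x k} := by
      ext ω
      simp only [Set.mem_preimage, Set.mem_prod, Set.mem_singleton_iff, hpre, Set.mem_ofPred_eq]
      constructor
      · rintro ⟨h1, h2⟩ k hk
        rcases Nat.le_succ_iff.1 hk with h | h
        · exact h1 k h
        · exact h ▸ h2
      · intro h
        exact ⟨fun k hk => h k (by omega), h _ le_rfl⟩
    have e2 : (Preorder.frestrictLe (π := fun _ : ℕ => V) n) ⁻¹' {r} =
        {ω | ∀ k ≤ n, ω k = x k} := by
      ext ω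
      exact hpre ω
    have e3 : κ n r {x (n + 1)} = g n r (x (n + 1)) :=
      weightMeasure_apply_singleton _ _
    rw [e1, e2] at key
    change P {ω | ∀ k ≤ n, ω k = x k} • κ n r {x (n + 1)} =
      P {ω | ∀ k ≤ n + 1, ω k = x k} at key
    rw [← key, ih, e3, smul_eq_mul]
    have her : w n (e n r) = w n x := hdep _ _ _ fun k hk => by
      simp [e, r, hk]
    have her' : w (n + 1) (Function.update (e n r) (n + 1) (x (n + 1))) = w (n + 1) x :=
      hdep _ _ _ fun k hk => by
        rcases Nat.le_succ_iff.1 hk with h | h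
        · rw [Function.update_of_ne (by omega)]
          simp [e, r, h]
        · subst h; simp
    by_cases hw : w n x = 0
    · rw [hw, zero_mul]
      have := ENNReal.le_tsum (f := fun v => w (n + 1) (Function.update x (n + 1) v)) (x (n + 1))
      rw [hs, hw] at this
      rw [Function.update_eq_self] at this
      exact (le_antisymm this zero_le).symm
    · simp only [g, her, hw, if_false, her']
      rw [← mul_assoc, ENNReal.mul_inv_cancel hw (htop _ _), one_mul]

/-! ### Homogeneous open quantum random walks -/

/-- A homogeneous open quantum random walk on a lattice of `ℝ^d` with internal Hilbert space `𝔥`: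
a locally finite (i.e. discrete) subgroup `V` of `ℝ^d`, positively generated by a set `S ≠ {0}`,
and operators `L s`, `s ∈ S`, on `𝔥` with `∑ s, (L s)* (L s) = Id`. -/
structure OpenQuantumRandomWalk (d : ℕ) (𝔥 : Type*) [NormedAddCommGroup 𝔥]
    [InnerProductSpace ℂ 𝔥] [CompleteSpace 𝔥] where
  /-- the lattice -/
  V : AddSubgroup (EuclideanSpace ℝ (Fin d))
  discrete : DiscreteTopology V
  /-- the set of possible steps -/
  S : Set V
  S_ne : S ≠ {0}
  closure_S : AddSubmonoid.closure S = ⊤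
  /-- the transition operators -/
  L : S → (𝔥 →L[ℂ] 𝔥)
  stochastic : HasSum (fun s : S => star (L s) * L s) 1

/-- The map `ρ ↦ ∑ k, A k * ρ * (A k)*` on the operators on `𝔥`. The sum is taken in the space of
bounded maps on operators (see `krausMap_apply` for its pointwise form). -/
noncomputable def krausMap {𝔥 : Type*} [NormedAddCommGroup 𝔥] [InnerProductSpace ℂ 𝔥]
    [CompleteSpace 𝔥] {K : Type*} (A : K → (𝔥 →L[ℂ] 𝔥)) :
    (𝔥 →L[ℂ] 𝔥) →L[ℂ] (𝔥 →L[ℂ] 𝔥) :=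
  ∑' k, ContinuousLinearMap.mulLeftRight ℂ (𝔥 →L[ℂ] 𝔥) (A k) (star (A k))

theorem summable_krausMap {𝔥 : Type*} [NormedAddCommGroup 𝔥] [InnerProductSpace ℂ 𝔥]
    [CompleteSpace 𝔥] [FiniteDimensional ℂ 𝔥] {K : Type*} (A : K → (𝔥 →L[ℂ] 𝔥))
    (hA : Summable fun k => star (A k) * A k) :
    Summable fun k => ContinuousLinearMap.mulLeftRight ℂ (𝔥 →L[ℂ] 𝔥) (A k) (star (A k)) := by
  have : FiniteDimensional ℝ (𝔥 →L[ℂ] 𝔥) := FiniteDimensional.trans ℝ ℂ (𝔥 →L[ℂ] 𝔥)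
  refine Summable.of_norm_bounded (summable_norm_iff.2 hA) fun k => ?_
  refine (ContinuousLinearMap.opNorm_mulLeftRight_apply_apply_le _ _ _ _).trans ?_
  rw [norm_star, CStarRing.norm_star_mul_self]

theorem krausMap_apply {𝔥 : Type*} [NormedAddCommGroup 𝔥] [InnerProductSpace ℂ 𝔥]
    [CompleteSpace 𝔥] [FiniteDimensional ℂ 𝔥] {K : Type*} (A : K → (𝔥 →L[ℂ] 𝔥))
    (hA : Summable fun k => star (A k) * A k) (ρ : 𝔥 →L[ℂ] 𝔥) :
    HasSum (fun k => A k * ρ * star (A k)) (krausMap A ρ) := by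
  have h := (summable_krausMap A hA).hasSum
  have h2 := ContinuousLinearMap.hasSum
    (ContinuousLinearMap.apply ℂ (𝔥 →L[ℂ] 𝔥) ρ : _ →L[ℂ] (𝔥 →L[ℂ] 𝔥)) h
  simp only [ContinuousLinearMap.apply_apply, ContinuousLinearMap.mulLeftRight_apply] at h2
  exact h2

/-- `Φ` is irreducible if the only orthogonal projections `P` reducing `Φ`, i.e. such that `Φ` maps
`P B(𝔥) P` into itself, are `0` and `Id`. -/
def IsIrreducibleMap {𝔥 : Type*} [NormedAddCommGroup 𝔥] [InnerProductSpace ℂ 𝔥]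
    [CompleteSpace 𝔥] (Φ : (𝔥 →L[ℂ] 𝔥) →L[ℂ] (𝔥 →L[ℂ] 𝔥)) : Prop :=
  ∀ P : 𝔥 →L[ℂ] 𝔥, IsStarProjection P → (∀ ρ, ∃ σ, Φ (P * ρ * P) = P * σ * P) → P = 0 ∨ P = 1

/-- The real part of the trace (the trace itself is real for positive operators). -/
noncomputable def reTrace (𝔥 : Type*) [NormedAddCommGroup 𝔥] [InnerProductSpace ℂ 𝔥]
    (A : 𝔥 →L[ℂ] 𝔥) : ℝ :=
  (LinearMap.trace ℂ 𝔥 (A : 𝔥 →ₗ[ℂ] 𝔥)).re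

theorem reTrace_nonneg {𝔥 : Type*} [NormedAddCommGroup 𝔥] [InnerProductSpace ℂ 𝔥]
    {A : 𝔥 →L[ℂ] 𝔥} (hA : A.IsPositive) : 0 ≤ reTrace 𝔥 A :=
  (Complex.nonneg_iff.1 hA.toLinearMap.trace_nonneg).1

namespace OpenQuantumRandomWalk

section

variable {d : ℕ} {𝔥 : Type*} [NormedAddCommGroup 𝔥] [InnerProductSpace ℂ 𝔥] [CompleteSpace 𝔥]

/-- The auxiliary map `𝔏 : ρ ↦ ∑ s, L s * ρ * (L s)*`. -/
noncomputable def auxMap (W : OpenQuantumRandomWalk d 𝔥) :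
    (𝔥 →L[ℂ] 𝔥) →L[ℂ] (𝔥 →L[ℂ] 𝔥) :=
  krausMap W.L

/-- The deformed operators `L_s^{(u)} = exp (⟨u, s⟩ / 2) L_s`. -/
noncomputable def deformedL (W : OpenQuantumRandomWalk d 𝔥) (u : EuclideanSpace ℝ (Fin d))
    (s : W.S) : 𝔥 →L[ℂ] 𝔥 :=
  ((Real.exp (⟪u, ((s : W.V) : EuclideanSpace ℝ (Fin d))⟫_ℝ / 2) : ℝ) : ℂ) • W.L s

/-- The deformed map `𝔏_u : ρ ↦ ∑ s, L_s^{(u)} * ρ * (L_s^{(u)})*`. -/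
noncomputable def deformedMap (W : OpenQuantumRandomWalk d 𝔥) (u : EuclideanSpace ℝ (Fin d)) :
    (𝔥 →L[ℂ] 𝔥) →L[ℂ] (𝔥 →L[ℂ] 𝔥) :=
  krausMap (W.deformedL u)

/-- The condition that all the deformed maps `𝔏_u` are defined: the series
`∑ s, (L_s^{(u)})* L_s^{(u)}` converges for every `u`. It holds whenever `S` is finite
(see `deformable_of_finite`). -/
def Deformable (W : OpenQuantumRandomWalk d 𝔥) : Prop :=
  ∀ u : EuclideanSpace ℝ (Fin d), Summable fun s : W.S => star (W.deformedL u s) * W.deformedL u s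

theorem deformable_of_finite (W : OpenQuantumRandomWalk d 𝔥) (h : W.S.Finite) : W.Deformable := by
  intro u
  have := h.to_subtype
  exact summable_of_hasFiniteSupport (Set.toFinite _)

/-- The Legendre transform `I x = sup_u (⟨u, x⟩ - log λ_u)`, where `λ_u` is the spectral radius of
`𝔏_u`, as an extended real number. -/
noncomputable def rate (W : OpenQuantumRandomWalk d 𝔥) (x : EuclideanSpace ℝ (Fin d)) : EReal :=
  ⨆ u : EuclideanSpace ℝ (Fin d),
    ((⟪u, x⟫_ℝ : ℝ) : EReal) - ENNReal.log (spectralRadius ℂ (W.deformedMap u))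

/-- A state `∑ i, ρ(i) ⊗ |i⟩⟨i|` on `𝔥 ⊗ ℂ^V`, diagonal in the position: positive operators
`ρ(i)` whose traces add up to one. -/
structure DiagonalState (W : OpenQuantumRandomWalk d 𝔥) where
  /-- the diagonal blocks -/
  block : W.V → (𝔥 →L[ℂ] 𝔥)
  isPositive : ∀ i, (block i).IsPositive
  trace_one : HasSum (fun i => reTrace 𝔥 (block i)) 1

open scoped Classical in
/-- The operator `L_v` of the transition by `v`, which is `0` if `v` is not in `S`. -/
noncomputable def step (W : OpenQuantumRandomWalk d 𝔥) (v : W.V) : 𝔥 →L[ℂ] 𝔥 :=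
  if h : v ∈ W.S then W.L ⟨v, h⟩ else 0

/-- For a path `x` with steps `s_k = x k - x (k-1)`, the operator
`L_{s_p} ⋯ L_{s_1} ρ(x 0) L_{s_1}* ⋯ L_{s_p}*`, which is `0` if some step is not in `S`. -/
noncomputable def pathState (W : OpenQuantumRandomWalk d 𝔥) (ρ : W.DiagonalState) (x : ℕ → W.V) :
    ℕ → (𝔥 →L[ℂ] 𝔥)
  | 0 => ρ.block (x 0)
  | p + 1 => W.step (x (p + 1) - x p) * W.pathState ρ x p * star (W.step (x (p + 1) - x p))

instance (W : OpenQuantumRandomWalk d 𝔥) : DiscreteTopology W.V := W.discrete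

instance (W : OpenQuantumRandomWalk d 𝔥) : Countable W.V := countable_of_Lindelof_of_discrete

theorem hasSum_step (W : OpenQuantumRandomWalk d 𝔥) :
    HasSum (fun v => star (W.step v) * W.step v) 1 := by
  refine (Subtype.val_injective.hasSum_iff (f := fun v => star (W.step v) * W.step v) ?_).1
    (?_ : HasSum ((fun v => star (W.step v) * W.step v) ∘ ((↑) : W.S → W.V)) 1)
  · intro v hv
    have : v ∉ W.S := fun h => hv ⟨⟨v, h⟩, rfl⟩
    simp [step, this]
  · convert W.stochastic using 2 with s
    simp [step]

theorem pathState_congr (W : OpenQuantumRandomWalk d 𝔥) (ρ : W.DiagonalState) (n : ℕ)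
    (x y : ℕ → W.V) (h : ∀ k ≤ n, x k = y k) : W.pathState ρ x n = W.pathState ρ y n := by
  induction n with
  | zero => simp [pathState, h 0 le_rfl]
  | succ n ih =>
    simp only [pathState]
    rw [ih fun k hk => h k (by omega), h n (by omega), h (n + 1) le_rfl]

theorem pathState_isPositive (W : OpenQuantumRandomWalk d 𝔥) (ρ : W.DiagonalState) (x : ℕ → W.V)
    (n : ℕ) : (W.pathState ρ x n).IsPositive := by
  induction n with
  | zero => exact ρ.isPositive _
  | succ n ih =>
    have := ih.conj_adjoint (W.step (x (n + 1) - x n))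
    rwa [← ContinuousLinearMap.star_eq_adjoint] at this

variable [FiniteDimensional ℂ 𝔥]

theorem hasSum_reTrace_step (W : OpenQuantumRandomWalk d 𝔥) (σ : 𝔥 →L[ℂ] 𝔥) (i : W.V) :
    HasSum (fun v => reTrace 𝔥 (W.step (v - i) * σ * star (W.step (v - i)))) (reTrace 𝔥 σ) := by
  have h1 : HasSum (fun v => star (W.step (v - i)) * W.step (v - i)) 1 :=
    (Equiv.subRight i).hasSum_iff.2 W.hasSum_step
  let T : (𝔥 →L[ℂ] 𝔥) →ₗ[ℝ] ℝ :=
    { toFun := fun A => reTrace 𝔥 (A * σ)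
      map_add' := fun A B => by simp [reTrace, add_mul]
      map_smul' := fun c A => by
        simp [reTrace] }
  have : FiniteDimensional ℝ (𝔥 →L[ℂ] 𝔥) := FiniteDimensional.trans ℝ ℂ (𝔥 →L[ℂ] 𝔥)
  have h2 := h1.mapL (LinearMap.toContinuousLinearMap T)
  have e : ∀ A : 𝔥 →L[ℂ] 𝔥, reTrace 𝔥 (A * σ * star A) = reTrace 𝔥 (star A * A * σ) := fun A => by
    have := LinearMap.trace_mul_comm ℂ ((A * σ : 𝔥 →L[ℂ] 𝔥) : 𝔥 →ₗ[ℂ] 𝔥)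
      ((star A : 𝔥 →L[ℂ] 𝔥) : 𝔥 →ₗ[ℂ] 𝔥)
    unfold reTrace
    rw [mul_assoc (star A)]
    exact congrArg Complex.re this
  simp only [e]
  have e1 : (LinearMap.toContinuousLinearMap T) 1 = reTrace 𝔥 σ := by
    change reTrace 𝔥 (1 * σ) = _
    rw [one_mul]
  rw [e1] at h2
  exact h2

/-- There is exactly one probability measure on the path space `ℕ → V` for which the path
`x 0, …, x p` is observed with probability `Tr (L_{s_p} ⋯ L_{s_1} ρ(x 0) L_{s_1}* ⋯ L_{s_p}*)`. -/
theorem existsUnique_pathLaw (W : OpenQuantumRandomWalk d 𝔥) (ρ : W.DiagonalState) :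
    ∃! P : Measure (ℕ → W.V), IsProbabilityMeasure P ∧
      ∀ (p : ℕ) (x : ℕ → W.V), P {ω | ∀ k ≤ p, ω k = x k} =
        ENNReal.ofReal (reTrace 𝔥 (W.pathState ρ x p)) := by
  obtain ⟨P, hP, h⟩ := exists_pathMeasure
    (fun p x => ENNReal.ofReal (reTrace 𝔥 (W.pathState ρ x p)))
    (fun n x y hxy => by rw [W.pathState_congr ρ n x y hxy])
    (fun x => by
      simp only [pathState, Function.update_self]
      rw [← ENNReal.ofReal_tsum_of_nonneg (fun i => reTrace_nonneg (ρ.isPositive i))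
        ρ.trace_one.summable, ρ.trace_one.tsum_eq, ENNReal.ofReal_one])
    (fun n x => by
      have e : ∀ v, W.pathState ρ (Function.update x (n + 1) v) (n + 1) =
          W.step (v - x n) * W.pathState ρ x n * star (W.step (v - x n)) := fun v => by
        simp only [pathState]
        rw [Function.update_self, Function.update_of_ne (by omega),
          W.pathState_congr ρ n _ x fun k hk => Function.update_of_ne (by omega) _ _]
      have hs := W.hasSum_reTrace_step (W.pathState ρ x n) (x n)
      simp only [e]
      rw [← ENNReal.ofReal_tsum_of_nonneg _ hs.summable, hs.tsum_eq]
      intro v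
      rw [← e]
      exact reTrace_nonneg (W.pathState_isPositive ρ _ _))
  refine ⟨P, ⟨hP, h⟩, fun Q hQ => ?_⟩
  exact (pathMeasure_unique fun n x => (h n x).trans (hQ.2 n x).symm).symm

/-- The law `ℙ_ρ` on the path space `ℕ → V`, whose coordinate maps are the positions `X_p`. -/
noncomputable def pathLaw (W : OpenQuantumRandomWalk d 𝔥) (ρ : W.DiagonalState) :
    Measure (ℕ → W.V) :=
  (W.existsUnique_pathLaw ρ).choose

/-- The defining property of `ℙ_ρ`. -/
theorem pathLaw_spec (W : OpenQuantumRandomWalk d 𝔥) (ρ : W.DiagonalState) :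
    IsProbabilityMeasure (W.pathLaw ρ) ∧
      ∀ (p : ℕ) (x : ℕ → W.V), W.pathLaw ρ {ω | ∀ k ≤ p, ω k = x k} =
        ENNReal.ofReal (reTrace 𝔥 (W.pathState ρ x p)) :=
  (W.existsUnique_pathLaw ρ).choose_spec.1

/-- The probability `ℙ_ρ ((X_p - X_0) / p ∈ A)`. -/
noncomputable def meanProb (W : OpenQuantumRandomWalk d 𝔥) (ρ : W.DiagonalState) (p : ℕ)
    (A : Set (EuclideanSpace ℝ (Fin d))) : ℝ≥0∞ :=
  W.pathLaw ρ {ω | (p : ℝ)⁻¹ •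
    ((ω p : EuclideanSpace ℝ (Fin d)) - (ω 0 : EuclideanSpace ℝ (Fin d))) ∈ A}

end

end OpenQuantumRandomWalk

/-- A good rate function: `[0, ∞]`-valued, lower semicontinuous, with compact level sets. -/
def IsGoodRateFunction {E : Type*} [TopologicalSpace E] (I : E → EReal) : Prop :=
  (∀ x, 0 ≤ I x) ∧ LowerSemicontinuous I ∧ ∀ α : ℝ, IsCompact {x | I x ≤ (α : EReal)}

/-- The large deviation bounds (at speed `p`) with rate function `I` for the distributions
`prob p`, `p ≥ 1`. -/
def SatisfiesLDP {E : Type*} [TopologicalSpace E] (prob : ℕ → Set E → ℝ≥0∞) (I : E → EReal) :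
    Prop :=
  ∀ G F : Set E, IsOpen G → IsClosed F → G ⊆ F →
    -(⨅ x ∈ G, I x) ≤ liminf (fun p : ℕ => ENNReal.log (prob p G) / (p : EReal)) atTop ∧
    liminf (fun p : ℕ => ENNReal.log (prob p G) / (p : EReal)) atTop ≤
      limsup (fun p : ℕ => ENNReal.log (prob p F) / (p : EReal)) atTop ∧
    limsup (fun p : ℕ => ENNReal.log (prob p F) / (p : EReal)) atTop ≤ -(⨅ x ∈ F, I x)

/-! ### Positive operators -/

section PositiveOperators

variable {𝔥 : Type*} [NormedAddCommGroup 𝔥] [InnerProductSpace ℂ 𝔥] [CompleteSpace 𝔥]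

/-! The exponential moment `E exp ⟨u, X_p - X_0⟩` is a sum over paths, and summing out the last step
replaces the observable `B` in `Tr (B ρ_x)` by its image under the trace dual of `𝔏_u`
(`pathSum_succ`). If `M` is a strictly positive eigenvector of this dual, with eigenvalue `λ_u`,
then starting from `M` gives an exactly geometric sequence. Since `1` lies between two positive
multiples of `M`, the moment lies between `c λ_u ^ p` and `C λ_u ^ p` for every `p` and every
initial state (`exists_pathSum_bounds`). Periodicity does no harm, because no convergence of `𝔏_u ^
p / λ_u ^ p` is asked for.

The eigenvectors come from Perron–Frobenius theory (`krausMap_perronFrobenius`). Irreducibility says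
that the `L_s` have no common invariant subspace, which survives rescaling by `exp (⟨u, s⟩ / 2)`,
and it makes some power of `1 + 𝔏_u` turn any given nonzero positive operator into a strictly
positive one.

The function `Λ u = log λ_u` is continuous and differentiable along lines: continuity follows from
compactness and uniqueness of the normalised eigenvector, and the derivative from pairing the
perturbed eigenvalue equation with the unperturbed left eigenvector
(`continuous_logEigenvalue_and_hasDerivAt`).

What remains is a Gärtner–Ellis argument (`satisfiesLDP_legendre`). For the upper bound, a closed
set is covered by finitely many half-spaces. For the lower bound, exponential tilting concentrates
the mass near a gradient of `Λ`, and a quadratically penalised maximisation shows that gradients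
approximate every point of finite rate without raising the rate (`exists_gradient_near`). Convexity
of `Λ` never enters. -/

theorem IsStrictlyPositive.exists_pos_smul_one_le {X : 𝔥 →L[ℂ] 𝔥} (h : IsStrictlyPositive X) :
    ∃ c : ℝ, 0 < c ∧ c • (1 : 𝔥 →L[ℂ] 𝔥) ≤ X := by
  rcases subsingleton_or_nontrivial (𝔥 →L[ℂ] 𝔥) with _ | _
  · exact ⟨1, one_pos, (Subsingleton.elim _ _).le⟩
  have : ∃ r > 0, algebraMap ℝ (𝔥 →L[ℂ] 𝔥) r ≤ X := by
    refine (CFC.exists_pos_algebraMap_le_iff h.isSelfAdjoint).2 fun x hx => h.spectrum_pos hx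
  simpa [Algebra.algebraMap_eq_smul_one] using this

theorem le_norm_smul_one {X : 𝔥 →L[ℂ] 𝔥} (h : IsSelfAdjoint X) :
    X ≤ ‖X‖ • (1 : 𝔥 →L[ℂ] 𝔥) := by
  simpa [Algebra.algebraMap_eq_smul_one] using h.le_algebraMap_norm_self

theorem exists_smul_le_of_isStrictlyPositive {X Y : 𝔥 →L[ℂ] 𝔥} (hX : IsStrictlyPositive X)
    (hY : 0 ≤ Y) : ∃ c : ℝ, 0 < c ∧ c • Y ≤ X := by
  obtain ⟨c, hc, h⟩ := hX.exists_pos_smul_one_le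
  refine ⟨c / (‖Y‖ + 1), by positivity, le_trans ?_ h⟩
  have h1 : Y ≤ (‖Y‖ + 1) • (1 : 𝔥 →L[ℂ] 𝔥) := (le_norm_smul_one hY.isSelfAdjoint).trans
    (smul_le_smul_of_nonneg_right (by linarith) zero_le_one)
  calc (c / (‖Y‖ + 1)) • Y ≤ (c / (‖Y‖ + 1)) • ((‖Y‖ + 1) • (1 : 𝔥 →L[ℂ] 𝔥)) :=
        smul_le_smul_of_nonneg_left h1 (by positivity)
    _ = c • 1 := by rw [smul_smul, div_mul_cancel₀ _ (by positivity)]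

theorem apply_eq_zero_of_re_inner_nonpos {X : 𝔥 →L[ℂ] 𝔥} (hX : 0 ≤ X) {v : 𝔥}
    (h : (⟪X v, v⟫_ℂ).re ≤ 0) : X v = 0 := by
  obtain ⟨B, rfl⟩ := CStarAlgebra.nonneg_iff_eq_star_mul_self.1 hX
  have h1 := B.apply_norm_sq_eq_inner_adjoint_left v
  have h2 : ‖B v‖ ^ 2 ≤ 0 := h1.trans_le h
  have h3 : B v = 0 := norm_eq_zero.1 (pow_eq_zero_iff two_ne_zero |>.1
    (h2.antisymm (sq_nonneg _)))
  change star B (B v) = 0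
  rw [h3, map_zero]

theorem apply_eq_zero_of_le {X Y : 𝔥 →L[ℂ] 𝔥} (hX : 0 ≤ X) (hXY : X ≤ Y) {v : 𝔥}
    (h : Y v = 0) : X v = 0 := by
  refine apply_eq_zero_of_re_inner_nonpos hX ?_
  have := ((ContinuousLinearMap.le_def _ _).1 hXY).re_inner_nonneg_left v
  simpa [h] using this

variable [FiniteDimensional ℂ 𝔥]

theorem isStrictlyPositive_of_ker_eq_bot {X : 𝔥 →L[ℂ] 𝔥} (hX : 0 ≤ X)
    (h : LinearMap.ker (X : 𝔥 →ₗ[ℂ] 𝔥) = ⊥) : IsStrictlyPositive X :=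
  IsUnit.isStrictlyPositive (X.isUnit_iff_isUnit_toLinearMap.2
    ((LinearMap.isUnit_iff_ker_eq_bot _).2 h)) hX

theorem reTrace_eq_sum_inner (X : 𝔥 →L[ℂ] 𝔥) :
    reTrace 𝔥 X = ∑ i, (⟪stdOrthonormalBasis ℂ 𝔥 i, X (stdOrthonormalBasis ℂ 𝔥 i)⟫_ℂ).re := by
  rw [reTrace, LinearMap.trace_eq_sum_inner _ (stdOrthonormalBasis ℂ 𝔥), Complex.re_sum]
  rfl

/-- The real part of the trace as a continuous real linear form. -/
noncomputable def reTraceCLM (𝔥 : Type*) [NormedAddCommGroup 𝔥] [InnerProductSpace ℂ 𝔥]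
    [CompleteSpace 𝔥] [FiniteDimensional ℂ 𝔥] : (𝔥 →L[ℂ] 𝔥) →L[ℝ] ℝ :=
  have : FiniteDimensional ℝ (𝔥 →L[ℂ] 𝔥) := FiniteDimensional.trans ℝ ℂ (𝔥 →L[ℂ] 𝔥)
  LinearMap.toContinuousLinearMap
    { toFun := reTrace 𝔥
      map_add' := fun A B => by simp [reTrace]
      map_smul' := fun c A => by simp [reTrace] }

@[simp] theorem reTraceCLM_apply (X : 𝔥 →L[ℂ] 𝔥) : reTraceCLM 𝔥 X = reTrace 𝔥 X := rfl

theorem reTrace_sub (X Y : 𝔥 →L[ℂ] 𝔥) : reTrace 𝔥 (X - Y) = reTrace 𝔥 X - reTrace 𝔥 Y :=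
  (reTraceCLM 𝔥).map_sub X Y

theorem reTrace_smul (c : ℝ) (X : 𝔥 →L[ℂ] 𝔥) : reTrace 𝔥 (c • X) = c * reTrace 𝔥 X :=
  (reTraceCLM 𝔥).map_smul c X

theorem reTrace_mul_comm (X Y : 𝔥 →L[ℂ] 𝔥) : reTrace 𝔥 (X * Y) = reTrace 𝔥 (Y * X) :=
  congrArg Complex.re (LinearMap.trace_mul_comm ℂ (X : 𝔥 →ₗ[ℂ] 𝔥) (Y : 𝔥 →ₗ[ℂ] 𝔥))

theorem reTrace_mul_nonneg {X Y : 𝔥 →L[ℂ] 𝔥} (hX : 0 ≤ X) (hY : 0 ≤ Y) :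
    0 ≤ reTrace 𝔥 (X * Y) := by
  obtain ⟨B, rfl⟩ := CStarAlgebra.nonneg_iff_eq_star_mul_self.1 hX
  rw [mul_assoc, reTrace_mul_comm]
  exact reTrace_nonneg ((ContinuousLinearMap.nonneg_iff_isPositive _).1
    (star_right_conjugate_nonneg hY B))

theorem reTrace_mul_le_mul {X Y Z : 𝔥 →L[ℂ] 𝔥} (hXY : X ≤ Y) (hZ : 0 ≤ Z) :
    reTrace 𝔥 (X * Z) ≤ reTrace 𝔥 (Y * Z) := by
  have := reTrace_mul_nonneg (sub_nonneg.2 hXY) hZ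
  rw [sub_mul, reTrace_sub] at this
  linarith

theorem reTrace_pos {X : 𝔥 →L[ℂ] 𝔥} (hX : 0 ≤ X) (h0 : X ≠ 0) : 0 < reTrace 𝔥 X := by
  have hp := (ContinuousLinearMap.nonneg_iff_isPositive _).1 hX
  refine (reTrace_nonneg hp).lt_of_ne fun h => h0 ?_
  rw [reTrace_eq_sum_inner] at h
  have h' := (Finset.sum_eq_zero_iff_of_nonneg
    fun i _ => hp.re_inner_nonneg_right (stdOrthonormalBasis ℂ 𝔥 i)).1 h.symm
  have hz : (X : 𝔥 →ₗ[ℂ] 𝔥) = 0 := (stdOrthonormalBasis ℂ 𝔥).toBasis.ext fun i => by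
    have h1 := h' i (Finset.mem_univ i)
    have h3 := apply_eq_zero_of_re_inner_nonpos hX (v := stdOrthonormalBasis ℂ 𝔥 i) (by
      rw [hp.inner_left_eq_inner_right]
      exact h1.le)
    simpa using h3
  ext v
  exact LinearMap.congr_fun hz v

theorem reTrace_mul_pos {X Y : 𝔥 →L[ℂ] 𝔥} (hX : IsStrictlyPositive X) (hY : 0 ≤ Y) (h0 : Y ≠ 0) :
    0 < reTrace 𝔥 (X * Y) := by
  obtain ⟨c, hc, h⟩ := hX.exists_pos_smul_one_le
  have := reTrace_mul_le_mul h hY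
  rw [smul_mul_assoc, one_mul, reTrace_smul] at this
  have := mul_pos hc (reTrace_pos hY h0)
  linarith

end PositiveOperators

/-! ### Perron–Frobenius theory of positive maps on operators -/

section PerronFrobenius

variable {𝔥 : Type*} [NormedAddCommGroup 𝔥] [InnerProductSpace ℂ 𝔥] [CompleteSpace 𝔥]
  {Φ : (𝔥 →L[ℂ] 𝔥) →L[ℂ] (𝔥 →L[ℂ] 𝔥)}

theorem map_real_smul_operator (Φ : (𝔥 →L[ℂ] 𝔥) →L[ℂ] (𝔥 →L[ℂ] 𝔥)) (c : ℝ) (X : 𝔥 →L[ℂ] 𝔥) :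
    Φ (c • X) = c • Φ X :=
  LinearMap.map_smul_of_tower (Φ : (𝔥 →L[ℂ] 𝔥) →ₗ[ℂ] (𝔥 →L[ℂ] 𝔥)) c X

theorem map_mono_of_map_nonneg (hpos : ∀ X, 0 ≤ X → 0 ≤ Φ X) {X Y : 𝔥 →L[ℂ] 𝔥} (h : X ≤ Y) :
    Φ X ≤ Φ Y := by
  have := hpos _ (sub_nonneg.2 h)
  rwa [map_sub, sub_nonneg] at this

theorem pow_map_nonneg (hpos : ∀ X, 0 ≤ X → 0 ≤ Φ X) (n : ℕ) (X : 𝔥 →L[ℂ] 𝔥) (hX : 0 ≤ X) :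
    0 ≤ (Φ ^ n) X := by
  induction n with
  | zero => exact hX
  | succ n ih => rw [pow_succ']; exact hpos _ ih

theorem one_add_map_nonneg (hpos : ∀ X, 0 ≤ X → 0 ≤ Φ X) (X : 𝔥 →L[ℂ] 𝔥) (hX : 0 ≤ X) :
    0 ≤ (1 + Φ) X :=
  add_nonneg hX (hpos X hX)

theorem pow_apply_of_apply_eq_smul {c : ℝ} {X : 𝔥 →L[ℂ] 𝔥} (h : Φ X = c • X) (n : ℕ) :
    (Φ ^ n) X = c ^ n • X := by
  induction n with
  | zero => simp
  | succ n ih =>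
    rw [pow_succ']
    change Φ ((Φ ^ n) X) = _
    rw [ih, map_real_smul_operator, h, smul_smul, pow_succ]

/-- On an eigenvector the improving map `(1 + Φ) ^ n` is just multiplication by `(1 + μ) ^ n > 0`,
so it cannot create strict positivity that was not already there. -/
theorem isStrictlyPositive_of_eigenvector
    (himp : ∀ X, 0 ≤ X → X ≠ 0 → ∃ n : ℕ, IsStrictlyPositive (((1 + Φ) ^ n) X))
    {μ : ℝ} (hμ : 0 ≤ μ) {X : 𝔥 →L[ℂ] 𝔥} (hX : 0 ≤ X) (h0 : X ≠ 0) (h : Φ X = μ • X) :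
    IsStrictlyPositive X := by
  obtain ⟨n, hn⟩ := himp X hX h0
  have h1 : (1 + Φ) X = (1 + μ) • X := by
    change X + Φ X = _
    rw [h, add_smul, one_smul]
  rw [pow_apply_of_apply_eq_smul h1] at hn
  have h2 : (0 : ℝ) < (1 + μ) ^ n := by positivity
  have := hn.smul (inv_pos.2 h2)
  rwa [smul_smul, inv_mul_cancel₀ h2.ne', one_smul] at this

/-- A strictly positive difference leaves room for a further `c • Y` with `c > 0`. This is how
maximality of a coefficient is contradicted below. -/
theorem not_isStrictlyPositive_sub_of_forall_le {X Y : 𝔥 →L[ℂ] 𝔥} (hY : 0 ≤ Y) {t : ℝ}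
    (h : ∀ s : ℝ, s • Y ≤ X → s ≤ t) : ¬ IsStrictlyPositive (X - t • Y) := fun hs => by
  obtain ⟨c, hc, hle⟩ := exists_smul_le_of_isStrictlyPositive hs hY
  have := h (t + c) (by rw [add_smul, add_comm]; exact le_sub_iff_add_le.1 hle)
  linarith

variable [FiniteDimensional ℂ 𝔥]

/-- A positive map on operators with some power of `1 + Φ` improving positivity has a strictly
positive eigenvector. -/
theorem exists_isStrictlyPositive_eigenvector [Nontrivial 𝔥] (hpos : ∀ X, 0 ≤ X → 0 ≤ Φ X)
    (himp : ∀ X, 0 ≤ X → X ≠ 0 → ∃ n : ℕ, IsStrictlyPositive (((1 + Φ) ^ n) X)) :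
    ∃ (μ : ℝ) (R : 𝔥 →L[ℂ] 𝔥), 0 ≤ μ ∧ IsStrictlyPositive R ∧ ‖R‖ = 1 ∧ Φ R = μ • R := by
  have hprop : ProperSpace (𝔥 →L[ℂ] 𝔥) := FiniteDimensional.proper ℂ _
  have hbound : ∀ (t : ℝ) (X : 𝔥 →L[ℂ] 𝔥), 0 ≤ t → 0 ≤ X → ‖X‖ = 1 → t • X ≤ Φ X → t ≤ ‖Φ‖ := by
    intro t X ht hX h1 h
    have := CStarAlgebra.norm_le_norm_of_nonneg_of_le (smul_nonneg ht hX) h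
    rw [norm_smul, h1, Real.norm_of_nonneg ht, mul_one] at this
    refine this.trans ?_
    simpa [h1] using Φ.le_opNorm X
  -- Collatz–Wielandt: maximise `t` subject to `t • X ≤ Φ X` over normalised `X ≥ 0`. The bound `t ≤
  -- ‖Φ‖` is automatic, and listing it makes the set compact.
  let T : Set (ℝ × (𝔥 →L[ℂ] 𝔥)) :=
    {q | q.1 ∈ Set.Icc 0 ‖Φ‖ ∧ q.2 ∈ Metric.sphere 0 1 ∧ 0 ≤ q.2 ∧ q.1 • q.2 ≤ Φ q.2}
  have hT : IsCompact T := by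
    refine (isCompact_Icc.prod (isCompact_sphere (0 : 𝔥 →L[ℂ] 𝔥) 1)).of_isClosed_subset
      ?_ fun q hq => ⟨hq.1, hq.2.1⟩
    have h1 : IsClosed {q : ℝ × (𝔥 →L[ℂ] 𝔥) | 0 ≤ q.2} :=
      isClosed_le continuous_const continuous_snd
    have h2 : IsClosed {q : ℝ × (𝔥 →L[ℂ] 𝔥) | q.1 • q.2 ≤ Φ q.2} :=
      isClosed_le (continuous_fst.smul continuous_snd) (Φ.continuous.comp continuous_snd)
    exact (isClosed_Icc.preimage continuous_fst).inter
      ((Metric.isClosed_sphere.preimage continuous_snd).inter (h1.inter h2))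
  have hne : T.Nonempty := ⟨(0, 1), ⟨le_rfl, norm_nonneg _⟩, by simp, zero_le_one, by
    simpa using hpos 1 zero_le_one⟩
  obtain ⟨⟨μ, X⟩, ⟨hμ, hX1, hX, hle⟩, hmax⟩ := hT.exists_isMaxOn hne continuous_fst.continuousOn
  simp only [mem_sphere_zero_iff_norm] at hX1 hX hle hμ
  have hX0 : X ≠ 0 := fun h => by simp [h] at hX1
  have heig : Φ X = μ • X := by
    -- If the defect `Φ X - μ • X` were nonzero, some `(1 + Φ) ^ n` would make it strictly positive.
    -- This power commutes with `Φ`, so `Y = (1 + Φ) ^ n X` would satisfy the constraint with a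
    -- coefficient larger than `μ`.
    by_contra hcon
    obtain ⟨n, hn⟩ := himp (Φ X - μ • X) (sub_nonneg.2 hle) (sub_ne_zero.2 hcon)
    have hcomm : ((1 + Φ) ^ n) (Φ X - μ • X) =
        Φ (((1 + Φ) ^ n) X) - μ • ((1 + Φ) ^ n) X := by
      have : Commute ((1 + Φ) ^ n) Φ :=
        ((Commute.one_left Φ).add_left (Commute.refl Φ)).pow_left n
      rw [map_sub, map_real_smul_operator]
      congr 1
      exact congrArg (fun F : (𝔥 →L[ℂ] 𝔥) →L[ℂ] (𝔥 →L[ℂ] 𝔥) => F X) this.eq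
    set Y := ((1 + Φ) ^ n) X with hY
    have hYpos : 0 ≤ Y := pow_map_nonneg (one_add_map_nonneg hpos) n X hX
    have hXY : ∀ m : ℕ, X ≤ ((1 + Φ) ^ m) X := by
      intro m
      induction m with
      | zero => exact le_rfl
      | succ m ih =>
        rw [pow_succ']
        exact ih.trans (le_add_of_nonneg_right
          (hpos _ (pow_map_nonneg (one_add_map_nonneg hpos) m X hX)))
    have hY0 : Y ≠ 0 := fun h => hX0 (le_antisymm (h ▸ hXY n) hX)
    have hYn : 0 < ‖Y‖ := norm_pos_iff.2 hY0
    rw [hcomm] at hn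
    refine not_isStrictlyPositive_sub_of_forall_le hYpos (fun s hs => ?_) hn
    by_contra! hlt
    have hs0 : 0 ≤ s := hμ.1.trans hlt.le
    have hn1 : ‖(‖Y‖⁻¹ • Y)‖ = 1 := by
      rw [norm_smul, norm_inv, norm_norm, inv_mul_cancel₀ hYn.ne']
    have hp1 : 0 ≤ ‖Y‖⁻¹ • Y := smul_nonneg (inv_nonneg.2 hYn.le) hYpos
    have hl1 : s • ‖Y‖⁻¹ • Y ≤ Φ (‖Y‖⁻¹ • Y) := by
      rw [map_real_smul_operator, smul_comm]
      exact smul_le_smul_of_nonneg_left hs (inv_nonneg.2 hYn.le)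
    have hmem : (s, ‖Y‖⁻¹ • Y) ∈ T :=
      ⟨⟨hs0, hbound s _ hs0 hp1 hn1 hl1⟩, by simpa using hn1, hp1, hl1⟩
    have := hmax hmem
    simp only [Set.mem_ofPred_eq] at this
    linarith
  exact ⟨μ, X, hμ.1, isStrictlyPositive_of_eigenvector himp hμ.1 hX hX0 heig, hX1, heig⟩

/-- For the largest `t` with `t • Y ≤ R`, the difference `R - t • Y` is again a nonnegative
eigenvector. Were it nonzero it would be strictly positive, and `t` could be increased. The
normalisation then forces `t = 1`. -/
theorem eigenvector_unique [Nontrivial 𝔥]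
    (himp : ∀ X, 0 ≤ X → X ≠ 0 → ∃ n : ℕ, IsStrictlyPositive (((1 + Φ) ^ n) X))
    {μ : ℝ} (hμ : 0 ≤ μ) {R Y : 𝔥 →L[ℂ] 𝔥} (hR : 0 ≤ R) (hR1 : ‖R‖ = 1) (hRe : Φ R = μ • R)
    (hY : 0 ≤ Y) (hY1 : ‖Y‖ = 1) (hYe : Φ Y = μ • Y) : Y = R := by
  let T : Set ℝ := {t | t ∈ Set.Icc 0 1 ∧ t • Y ≤ R}
  have hb : ∀ t : ℝ, 0 ≤ t → t • Y ≤ R → t ≤ 1 := fun t ht h => by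
    have := CStarAlgebra.norm_le_norm_of_nonneg_of_le (smul_nonneg ht hY) h
    rwa [norm_smul, hY1, hR1, Real.norm_of_nonneg ht, mul_one] at this
  have hT : IsCompact T := isCompact_Icc.inter_right
    (isClosed_le (f := fun t : ℝ => t • Y) (g := fun _ => R)
      (continuous_id.smul continuous_const) continuous_const)
  obtain ⟨t, ⟨ht, hle⟩, hmax⟩ := hT.exists_isMaxOn
    ⟨0, ⟨le_rfl, zero_le_one⟩, by simpa using hR⟩ continuous_id.continuousOn
  have hzero : R - t • Y = 0 := by
    by_contra hne
    refine not_isStrictlyPositive_sub_of_forall_le hY (fun s hs => ?_)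
      (isStrictlyPositive_of_eigenvector himp hμ (sub_nonneg.2 hle) hne
        (by rw [map_sub, map_real_smul_operator, hRe, hYe, smul_sub, smul_comm]))
    rcases le_total s 0 with h | h
    · exact h.trans ht.1
    · exact hmax ⟨⟨h, hb s h hs⟩, hs⟩
  have hRt : R = t • Y := sub_eq_zero.1 hzero
  have ht1 : t = 1 := by
    have := congrArg norm hRt
    rw [hR1, norm_smul, hY1, Real.norm_of_nonneg ht.1, mul_one] at this
    exact this.symm
  rw [hRt, ht1, one_smul]

/-- A positive map is controlled by its value at `1`: a self-adjoint `H` satisfies `0 ≤ ‖H‖ • 1 - H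
≤ 2‖H‖ • 1`, which yields the factor 3, and the real and imaginary parts double it. The constant is
irrelevant for exponential growth rates. -/
theorem norm_map_le_of_map_nonneg (hpos : ∀ X, 0 ≤ X → 0 ≤ Φ X) (X : 𝔥 →L[ℂ] 𝔥) :
    ‖Φ X‖ ≤ 6 * ‖Φ 1‖ * ‖X‖ := by
  have key : ∀ H : 𝔥 →L[ℂ] 𝔥, IsSelfAdjoint H → ‖Φ H‖ ≤ 3 * ‖Φ 1‖ * ‖H‖ := by
    intro H hH
    have h1 : 0 ≤ ‖H‖ • (1 : 𝔥 →L[ℂ] 𝔥) - H := sub_nonneg.2 (le_norm_smul_one hH)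
    have h2 : ‖H‖ • (1 : 𝔥 →L[ℂ] 𝔥) - H ≤ (2 * ‖H‖) • (1 : 𝔥 →L[ℂ] 𝔥) := by
      have := le_norm_smul_one hH.neg
      rw [norm_neg] at this
      rw [two_mul, add_smul, sub_eq_add_neg]
      gcongr
    have h3 := map_mono_of_map_nonneg hpos h2
    have h4 := CStarAlgebra.norm_le_norm_of_nonneg_of_le (hpos _ h1) h3
    rw [map_sub, map_real_smul_operator, map_real_smul_operator, norm_smul,
      Real.norm_of_nonneg (by positivity)] at h4
    have h5 : ‖Φ H‖ ≤ ‖‖H‖ • Φ 1‖ + ‖‖H‖ • Φ 1 - Φ H‖ := norm_le_norm_add_norm_sub _ _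
    rw [norm_smul, norm_norm] at h5
    linarith
  have hre := key (realPart X) (realPart X).2
  have him := key (imaginaryPart X) (imaginaryPart X).2
  have hre' : ‖((realPart X : selfAdjoint (𝔥 →L[ℂ] 𝔥)) : 𝔥 →L[ℂ] 𝔥)‖ ≤ ‖X‖ := realPart.norm_le X
  have him' : ‖((imaginaryPart X : selfAdjoint (𝔥 →L[ℂ] 𝔥)) : 𝔥 →L[ℂ] 𝔥)‖ ≤ ‖X‖ :=
    imaginaryPart.norm_le X
  have hre2 := hre.trans (mul_le_mul_of_nonneg_left hre' (by positivity))
  have him2 := him.trans (mul_le_mul_of_nonneg_left him' (by positivity))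
  calc ‖Φ X‖ = ‖Φ (realPart X) + Complex.I • Φ (imaginaryPart X)‖ := by
        rw [← map_smul, ← map_add, realPart_add_I_smul_imaginaryPart]
    _ ≤ ‖Φ (realPart X)‖ + ‖Φ (imaginaryPart X)‖ := by
        refine (norm_add_le _ _).trans ?_
        rw [norm_smul, Complex.norm_I, one_mul]
    _ ≤ _ := by linarith

theorem norm_pow_le_of_eigenvector (hpos : ∀ X, 0 ≤ X → 0 ≤ Φ X)
    {μ : ℝ} (hμ : 0 ≤ μ) {R : 𝔥 →L[ℂ] 𝔥} (hR : IsStrictlyPositive R) (h : Φ R = μ • R) :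
    ∃ K : ℝ, 0 < K ∧ ∀ n : ℕ, ‖Φ ^ n‖ ≤ K * μ ^ n := by
  obtain ⟨c, hc, hcR⟩ := hR.exists_pos_smul_one_le
  refine ⟨6 * (c⁻¹ * (‖R‖ + 1)), by positivity, fun n => ?_⟩
  have h1 : ‖(Φ ^ n) 1‖ ≤ c⁻¹ * (‖R‖ + 1) * μ ^ n := by
    have h2 := map_mono_of_map_nonneg (pow_map_nonneg hpos n) hcR
    rw [map_real_smul_operator, pow_apply_of_apply_eq_smul h] at h2
    have h3 := CStarAlgebra.norm_le_norm_of_nonneg_of_le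
      (smul_nonneg hc.le (pow_map_nonneg hpos n 1 zero_le_one)) h2
    rw [norm_smul, norm_smul, Real.norm_of_nonneg hc.le, Real.norm_of_nonneg (pow_nonneg hμ n),
      ← le_inv_mul_iff₀ hc] at h3
    refine h3.trans ?_
    have : 0 ≤ c⁻¹ * μ ^ n := by positivity
    nlinarith
  refine ContinuousLinearMap.opNorm_le_bound _ (by positivity) fun X => ?_
  refine (norm_map_le_of_map_nonneg (pow_map_nonneg hpos n) X).trans ?_
  refine mul_le_mul_of_nonneg_right ?_ (norm_nonneg _)
  linarith

/-- The upper bound is Gelfand's formula applied to `‖Φ ^ n‖ ≤ K μ ^ n`; the lower bound holds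
because `μ` is an eigenvalue. -/
theorem spectralRadius_eq_of_eigenvector [Nontrivial 𝔥] (hpos : ∀ X, 0 ≤ X → 0 ≤ Φ X)
    {μ : ℝ} (hμ : 0 ≤ μ) {R : 𝔥 →L[ℂ] 𝔥} (hR : IsStrictlyPositive R) (h : Φ R = μ • R) :
    spectralRadius ℂ Φ = ENNReal.ofReal μ := by
  refine le_antisymm ?_ ?_
  · obtain ⟨K, hK, hle⟩ := norm_pow_le_of_eigenvector hpos hμ hR h
    have h1 : Tendsto (fun n : ℕ => ENNReal.ofReal (K ^ (1 / n : ℝ) * μ)) atTop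
        (𝓝 (ENNReal.ofReal μ)) := by
      have h2 : Tendsto (fun n : ℕ => K ^ (1 / n : ℝ)) atTop (𝓝 1) := by
        have := (tendsto_const_nhds (x := K)).rpow tendsto_one_div_atTop_nhds_zero_nat
          (Or.inl hK.ne')
        simpa using this
      have h3 := ENNReal.tendsto_ofReal (h2.mul_const μ)
      rwa [one_mul] at h3
    refine le_of_tendsto_of_tendsto
      (spectrum.pow_norm_pow_one_div_tendsto_nhds_spectralRadius Φ) h1 ?_
    filter_upwards [eventually_gt_atTop 0] with n hn
    refine ENNReal.ofReal_le_ofReal ?_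
    calc ‖Φ ^ n‖ ^ (1 / n : ℝ) ≤ (K * μ ^ n) ^ (1 / n : ℝ) :=
          Real.rpow_le_rpow (norm_nonneg _) (hle n) (by positivity)
      _ = K ^ (1 / n : ℝ) * μ := by
          rw [Real.mul_rpow hK.le (by positivity), one_div, Real.pow_rpow_inv_natCast hμ hn.ne']
  · have hmem : (μ : ℂ) ∈ spectrum ℂ Φ := by
      rw [spectrum.mem_iff]
      intro hu
      have hR0 : R ≠ 0 := hR.isUnit.ne_zero
      have hinj := (ContinuousLinearMap.isUnit_iff_bijective.1 hu).injective
      refine hR0 (hinj ?_)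
      rw [map_zero]
      change (algebraMap ℂ _ (μ : ℂ) : (𝔥 →L[ℂ] 𝔥) →L[ℂ] (𝔥 →L[ℂ] 𝔥)) R - Φ R = 0
      rw [Algebra.algebraMap_eq_smul_one, h]
      change (μ : ℂ) • R - μ • R = 0
      rw [Complex.coe_smul, sub_self]
    have h1 := le_iSup₂ (f := fun (k : ℂ) (_ : k ∈ spectrum ℂ Φ) => (‖k‖₊ : ℝ≥0∞)) _ hmem
    have e : ENNReal.ofReal μ = ‖(μ : ℂ)‖₊ := by
      rw [← ENNReal.ofReal_coe_nnreal, coe_nnnorm, Complex.norm_real, Real.norm_of_nonneg hμ]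
    rw [e]
    exact h1

end PerronFrobenius

/-! ### Irreducible families of operators and their Kraus maps -/

section Kraus

variable {𝔥 : Type*} [NormedAddCommGroup 𝔥] [InnerProductSpace ℂ 𝔥]

/-- A family of operators without nontrivial common invariant subspaces. -/
def IsIrreducibleFamily {K : Type*} (A : K → (𝔥 →L[ℂ] 𝔥)) : Prop :=
  ∀ p : Submodule ℂ 𝔥, (∀ k, ∀ v ∈ p, A k v ∈ p) → p = ⊥ ∨ p = ⊤

theorem IsIrreducibleFamily.smul {K : Type*} {A : K → (𝔥 →L[ℂ] 𝔥)} (h : IsIrreducibleFamily A)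
    {c : K → ℂ} (hc : ∀ k, c k ≠ 0) : IsIrreducibleFamily fun k => c k • A k := by
  intro p hp
  refine h p fun k v hv => ?_
  have := p.smul_mem (c k)⁻¹ (hp k v hv)
  rwa [_root_.smul_apply, smul_smul, inv_mul_cancel₀ (hc k), one_smul] at this

variable [CompleteSpace 𝔥]

/-- The orthogonal complement of a subspace invariant under the adjoints is invariant under the
operators themselves. -/
theorem IsIrreducibleFamily.star [FiniteDimensional ℂ 𝔥] {K : Type*} {A : K → (𝔥 →L[ℂ] 𝔥)}
    (h : IsIrreducibleFamily A) : IsIrreducibleFamily fun k => star (A k) := by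
  intro p hp
  have hinv : ∀ k, ∀ v ∈ pᗮ, A k v ∈ pᗮ := fun k v hv => by
    rw [Submodule.mem_orthogonal] at hv ⊢
    intro w hw
    rw [← ContinuousLinearMap.adjoint_inner_left]
    exact hv _ (hp k w hw)
  rcases h pᗮ hinv with h1 | h1
  · exact Or.inr (p.orthogonal_eq_bot_iff.1 h1)
  · exact Or.inl (p.orthogonal_eq_top_iff.1 h1)

variable [FiniteDimensional ℂ 𝔥] {K : Type*} {A : K → (𝔥 →L[ℂ] 𝔥)}

/-- The orthogonal projection `P` onto a common invariant subspace satisfies `P A_k P = A_k P`,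
hence reduces the Kraus map. -/
theorem isIrreducibleFamily_of_isIrreducibleMap (hA : Summable fun k => star (A k) * A k)
    (h : IsIrreducibleMap (krausMap A)) : IsIrreducibleFamily A := by
  intro p hp
  let P : 𝔥 →L[ℂ] 𝔥 := p.starProjection
  have hP : IsStarProjection P := isStarProjection_starProjection
  have hAP : ∀ k, P * (A k * P) = A k * P := fun k => by
    ext v
    exact p.starProjection_eq_self_iff.2 (hp k _ (p.starProjection_apply_mem v))
  have hAP' : ∀ k, P * star (A k) * P = P * star (A k) := fun k => by
    have := congrArg star (hAP k)
    simpa [star_mul, hP.isSelfAdjoint.star_eq] using this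
  have hsum : ∀ ρ, krausMap A (P * ρ * P) = P * krausMap A (P * ρ * P) * P := by
    intro ρ
    have h1 := krausMap_apply A hA (P * ρ * P)
    refine h1.unique ?_
    have h2 := (h1.mul_left P).mul_right P
    refine h2.congr_fun fun k => ?_
    calc A k * (P * ρ * P) * star (A k) = (A k * P) * ρ * (P * star (A k)) := by
          simp only [mul_assoc]
      _ = (P * (A k * P)) * ρ * (P * star (A k) * P) := by rw [hAP, hAP']
      _ = _ := by simp only [mul_assoc]
  rcases h P hP fun ρ => ⟨_, hsum ρ⟩ with h0 | h1
  · left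
    rw [eq_bot_iff]
    intro v hv
    have : P v = v := p.starProjection_eq_self_iff.2 hv
    rw [h0] at this
    exact this.symm
  · right
    rw [eq_top_iff]
    intro v _
    have : P v ∈ p := p.starProjection_apply_mem v
    rwa [h1] at this

theorem summable_mul_star (hA : Summable fun k => star (A k) * A k) :
    Summable fun k => star (star (A k)) * star (A k) := by
  have : FiniteDimensional ℝ (𝔥 →L[ℂ] 𝔥) := FiniteDimensional.trans ℝ ℂ (𝔥 →L[ℂ] 𝔥)
  refine Summable.of_norm_bounded (summable_norm_iff.2 hA) fun k => ?_
  rw [CStarRing.norm_star_mul_self, CStarRing.norm_star_mul_self, norm_star]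

theorem krausMap_nonneg (hA : Summable fun k => star (A k) * A k) (X : 𝔥 →L[ℂ] 𝔥) (hX : 0 ≤ X) :
    0 ≤ krausMap A X :=
  (krausMap_apply A hA X).nonneg fun k => star_right_conjugate_nonneg hX (A k)

/-- Each positive term `A_k X A_k*` lies below the sum, so it also kills `v`. Hence `⟨X A_k* v, A_k*
v⟩ = 0`, and positivity of `X` concludes. -/
theorem apply_star_eq_zero_of_krausMap_apply_eq_zero (hA : Summable fun k => star (A k) * A k)
    {X : 𝔥 →L[ℂ] 𝔥} (hX : 0 ≤ X) {v : 𝔥} (hv : krausMap A X v = 0) (k : K) :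
    X (star (A k) v) = 0 := by
  have h1 : A k * X * star (A k) ≤ krausMap A X :=
    le_hasSum (krausMap_apply A hA X) k fun j _ => star_right_conjugate_nonneg hX (A j)
  have h2 := apply_eq_zero_of_le (star_right_conjugate_nonneg hX (A k)) h1 hv
  refine apply_eq_zero_of_re_inner_nonpos hX ?_
  have h3 : ⟪X (star (A k) v), star (A k) v⟫_ℂ = ⟪(A k * X * star (A k)) v, v⟫_ℂ := by
    rw [ContinuousLinearMap.star_eq_adjoint, ContinuousLinearMap.adjoint_inner_right]
    rfl
  rw [h3, h2]
  simp

/-- Passing from `X` to `X + Φ X` can only shrink the kernel, and if the kernel stays the same it is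
invariant under all `A_k*`, hence trivial. So its dimension drops until it is zero. Powers of `Φ`
alone need not do this in the periodic case. -/
theorem exists_pow_isStrictlyPositive (hA : Summable fun k => star (A k) * A k)
    (hirr : IsIrreducibleFamily A) (X : 𝔥 →L[ℂ] 𝔥) (hX : 0 ≤ X) (h0 : X ≠ 0) :
    ∃ n : ℕ, IsStrictlyPositive (((1 + krausMap A) ^ n) X) := by
  induction h : Module.finrank ℂ (LinearMap.ker (X : 𝔥 →ₗ[ℂ] 𝔥)) using Nat.strong_induction_on
    generalizing X with
  | _ m ih =>
  by_cases hker : LinearMap.ker (X : 𝔥 →ₗ[ℂ] 𝔥) = ⊥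
  · exact ⟨0, isStrictlyPositive_of_ker_eq_bot hX hker⟩
  have hΦ := krausMap_nonneg hA X hX
  have hY : 0 ≤ X + krausMap A X := add_nonneg hX hΦ
  have hXY : X ≤ X + krausMap A X := le_add_of_nonneg_right hΦ
  have hY0 : X + krausMap A X ≠ 0 := fun h => h0 (le_antisymm (h ▸ hXY) hX)
  have hlt : LinearMap.ker ((X + krausMap A X : 𝔥 →L[ℂ] 𝔥) : 𝔥 →ₗ[ℂ] 𝔥) <
      LinearMap.ker (X : 𝔥 →ₗ[ℂ] 𝔥) := by
    refine lt_of_le_of_ne (fun v hv => apply_eq_zero_of_le hX hXY hv) fun heq => ?_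
    have hinv : ∀ k, ∀ v ∈ LinearMap.ker (X : 𝔥 →ₗ[ℂ] 𝔥),
        star (A k) v ∈ LinearMap.ker (X : 𝔥 →ₗ[ℂ] 𝔥) := fun k v hv => by
      rw [← heq] at hv
      exact apply_star_eq_zero_of_krausMap_apply_eq_zero hA hX
        (apply_eq_zero_of_le hΦ (le_add_of_nonneg_left hX) hv) k
    rcases hirr.star _ hinv with h1 | h1
    · exact hker h1
    · refine h0 (ContinuousLinearMap.ext fun v => ?_)
      have : v ∈ LinearMap.ker (X : 𝔥 →ₗ[ℂ] 𝔥) := h1 ▸ Submodule.mem_top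
      exact this
  obtain ⟨n, hn⟩ := ih _ (h ▸ Submodule.finrank_lt_finrank_of_lt hlt) _ hY hY0 rfl
  refine ⟨n + 1, ?_⟩
  rw [pow_succ]
  exact hn

/-- By cyclicity of the trace, the Kraus map of the adjoint family is the dual of `krausMap A` for
the trace pairing. -/
theorem reTrace_mul_krausMap (hA : Summable fun k => star (A k) * A k) (M X : 𝔥 →L[ℂ] 𝔥) :
    reTrace 𝔥 (M * krausMap A X) = reTrace 𝔥 (krausMap (fun k => star (A k)) M * X) := by
  have h1 := ((krausMap_apply A hA X).mul_left M).mapL (reTraceCLM 𝔥)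
  have h2 := ((krausMap_apply _ (summable_mul_star hA) M).mul_right X).mapL (reTraceCLM 𝔥)
  simp only [reTraceCLM_apply] at h1 h2
  refine h1.unique ?_
  convert h2 using 2 with k
  rw [star_star, ← mul_assoc, reTrace_mul_comm]
  simp only [mul_assoc]

/-- The Perron–Frobenius theorem for the Kraus map of an irreducible family of operators. -/
theorem krausMap_perronFrobenius [Nontrivial 𝔥] (hA : Summable fun k => star (A k) * A k)
    (hirr : IsIrreducibleFamily A) (hne : ∃ k, A k ≠ 0) :
    ∃ (μ : ℝ) (R M : 𝔥 →L[ℂ] 𝔥), 0 < μ ∧ spectralRadius ℂ (krausMap A) = ENNReal.ofReal μ ∧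
      IsStrictlyPositive R ∧ ‖R‖ = 1 ∧ krausMap A R = μ • R ∧
      IsStrictlyPositive M ∧ krausMap (fun k => star (A k)) M = μ • M := by
  have hpos := krausMap_nonneg hA
  obtain ⟨μ, R, hμ, hR, hR1, hRe⟩ := exists_isStrictlyPositive_eigenvector hpos
    (exists_pow_isStrictlyPositive hA hirr)
  have hA' := summable_mul_star hA
  obtain ⟨ν, M, hν, hM, hM1, hMe⟩ := exists_isStrictlyPositive_eigenvector (krausMap_nonneg hA')
    (exists_pow_isStrictlyPositive hA' hirr.star)
  -- Pairing the left and right eigenvectors identifies the two eigenvalues, because `Tr (M R) > 0`.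
  have hμν : ν = μ := by
    have h1 := reTrace_mul_krausMap hA M R
    rw [hRe, hMe, mul_smul_comm, smul_mul_assoc, reTrace_smul, reTrace_smul] at h1
    exact (mul_right_cancel₀ (reTrace_mul_pos hM hR.nonneg hR.isUnit.ne_zero).ne' h1).symm
  subst hμν
  refine ⟨ν, R, M, hμ.lt_of_ne fun h => ?_, spectralRadius_eq_of_eigenvector hpos hμ hR hRe,
    hR, hR1, hRe, hM, hMe⟩
  -- If the eigenvalue were `0`, then `R A_k* = 0` with `R` injective, so every `A_k` would vanish.
  obtain ⟨k, hk⟩ := hne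
  refine hk (star_eq_zero.1 (ContinuousLinearMap.ext fun v => ?_))
  have h2 := apply_star_eq_zero_of_krausMap_apply_eq_zero hA hR.nonneg (v := v)
    (by rw [hRe, ← h]; simp) k
  have hinj := (ContinuousLinearMap.isUnit_iff_bijective.1 hR.isUnit).injective
  exact hinj (h2.trans (map_zero R).symm)

end Kraus

/-! ### Perturbation of the Perron eigenvalue -/

section Perturbation

variable {𝔥 : Type*} [NormedAddCommGroup 𝔥] [InnerProductSpace ℂ 𝔥] [CompleteSpace 𝔥]
  [FiniteDimensional ℂ 𝔥] {Φ : (𝔥 →L[ℂ] 𝔥) →L[ℂ] (𝔥 →L[ℂ] 𝔥)}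

theorem Filter.Tendsto.operator_apply {ι : Type*} {l : Filter ι}
    {F : ι → (𝔥 →L[ℂ] 𝔥) →L[ℂ] (𝔥 →L[ℂ] 𝔥)} (hF : Tendsto F l (𝓝 Φ))
    {Q : ι → (𝔥 →L[ℂ] 𝔥)} {Y : 𝔥 →L[ℂ] 𝔥} (hQ : Tendsto Q l (𝓝 Y)) :
    Tendsto (fun i => F i (Q i)) l (𝓝 (Φ Y)) :=
  ((isBoundedBilinearMap_apply (𝕜 := ℂ) (E := 𝔥 →L[ℂ] 𝔥)
    (F := 𝔥 →L[ℂ] 𝔥)).continuous.tendsto (Φ, Y)).comp (hF.prodMk_nhds hQ)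

/-- The pairs `(ν i, Q i)` eventually stay in a compact set, and any cluster point is a normalised
nonnegative eigenpair of `Φ`. Pairing with `M` fixes its eigenvalue, and uniqueness fixes its
eigenvector. -/
theorem tendsto_perron_eigenvalue [Nontrivial 𝔥] {ι : Type*} {l : Filter ι}
    {F : ι → (𝔥 →L[ℂ] 𝔥) →L[ℂ] (𝔥 →L[ℂ] 𝔥)} (hF : Tendsto F l (𝓝 Φ))
    {ν : ι → ℝ} {Q : ι → (𝔥 →L[ℂ] 𝔥)} (hν : ∀ i, 0 ≤ ν i) (hQ : ∀ i, 0 ≤ Q i)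
    (hQ1 : ∀ i, ‖Q i‖ = 1) (hQe : ∀ i, F i (Q i) = ν i • Q i)
    (himp : ∀ X, 0 ≤ X → X ≠ 0 → ∃ n : ℕ, IsStrictlyPositive (((1 + Φ) ^ n) X))
    {μ : ℝ} (hμ : 0 ≤ μ) {R M : 𝔥 →L[ℂ] 𝔥} (hR : 0 ≤ R) (hR1 : ‖R‖ = 1)
    (hRe : Φ R = μ • R) (hM : IsStrictlyPositive M)
    (hMe : ∀ X, reTrace 𝔥 (M * Φ X) = μ * reTrace 𝔥 (M * X)) :
    Tendsto ν l (𝓝 μ) ∧ Tendsto Q l (𝓝 R) := by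
  have hprop : ProperSpace (𝔥 →L[ℂ] 𝔥) := FiniteDimensional.proper ℂ _
  have hK : IsCompact (Set.Icc 0 (‖Φ‖ + 1) ×ˢ Metric.sphere (0 : 𝔥 →L[ℂ] 𝔥) 1) :=
    isCompact_Icc.prod (isCompact_sphere _ _)
  have hmem : ∀ᶠ i in l, (ν i, Q i) ∈ Set.Icc 0 (‖Φ‖ + 1) ×ˢ Metric.sphere (0 : 𝔥 →L[ℂ] 𝔥) 1 := by
    filter_upwards [hF.norm.eventually_le_const (lt_add_one ‖Φ‖)] with i hi
    refine ⟨⟨hν i, ?_⟩, by simpa using hQ1 i⟩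
    have h1 := (F i).le_opNorm (Q i)
    rw [hQe, norm_smul, hQ1, Real.norm_of_nonneg (hν i)] at h1
    linarith
  have key : Tendsto (fun i => (ν i, Q i)) l (𝓝 (μ, R)) := by
    refine hK.tendsto_nhds_of_unique_mapClusterPt hmem fun y hy hcl => ?_
    obtain ⟨G, hG, hlim⟩ := mapClusterPt_iff_ultrafilter.1 hcl
    obtain ⟨ν', Y⟩ := y
    have hν' : 0 ≤ ν' := hy.1.1
    have hY1 : ‖Y‖ = 1 := by simpa using hy.2
    have h1 : Tendsto ν G (𝓝 ν') := (continuous_fst.tendsto _).comp hlim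
    have h2 : Tendsto Q G (𝓝 Y) := (continuous_snd.tendsto _).comp hlim
    have hY : 0 ≤ Y := ge_of_tendsto' h2 hQ
    have hY0 : Y ≠ 0 := fun h => by simp [h] at hY1
    have hYe : Φ Y = ν' • Y := by
      have h3 : Tendsto (fun i => F i (Q i)) G (𝓝 (Φ Y)) := Tendsto.operator_apply (hF.mono_left hG) h2
      simp only [hQe] at h3
      exact tendsto_nhds_unique h3 (h1.smul h2)
    have hνμ : ν' = μ := by
      have h3 := hMe Y
      rw [hYe, mul_smul_comm, reTrace_smul] at h3
      exact mul_right_cancel₀ (reTrace_mul_pos hM hY hY0).ne' h3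
    subst hνμ
    rw [eigenvector_unique himp hμ hR hR1 hRe hY hY1 hYe]
  exact ⟨(continuous_fst.tendsto _).comp key, (continuous_snd.tendsto _).comp key⟩

/-- Pairing with the left eigenvector at `0` gives `(ν t - ν 0) Tr (M Q_t) = Tr (M (F t - F 0)
Q_t)`. After division by `t`, continuity of `Q` at `0` suffices; the eigenvector need not be
differentiated. -/
theorem hasDerivAt_perron_eigenvalue {F : ℝ → (𝔥 →L[ℂ] 𝔥) →L[ℂ] (𝔥 →L[ℂ] 𝔥)}
    {D : (𝔥 →L[ℂ] 𝔥) →L[ℂ] (𝔥 →L[ℂ] 𝔥)} (hF : HasDerivAt F D 0)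
    {ν : ℝ → ℝ} {Q : ℝ → (𝔥 →L[ℂ] 𝔥)} {M : 𝔥 →L[ℂ] 𝔥} (hM : IsStrictlyPositive M)
    (hQ : ∀ t, 0 ≤ Q t) (hQ1 : ∀ t, ‖Q t‖ = 1)
    (hQe : ∀ t, F t (Q t) = ν t • Q t) (hlim : Tendsto Q (𝓝 0) (𝓝 (Q 0)))
    (hMe : ∀ X, reTrace 𝔥 (M * F 0 X) = ν 0 * reTrace 𝔥 (M * X)) :
    HasDerivAt ν (reTrace 𝔥 (M * D (Q 0)) / reTrace 𝔥 (M * Q 0)) 0 := by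
  have hpos : ∀ t, 0 < reTrace 𝔥 (M * Q t) := fun t =>
    reTrace_mul_pos hM (hQ t) fun h => by simpa [h] using hQ1 t
  rw [hasDerivAt_iff_tendsto_slope] at hF ⊢
  have hlim' : Tendsto Q (𝓝[≠] 0) (𝓝 (Q 0)) := hlim.mono_left nhdsWithin_le_nhds
  have hc : Continuous fun X : 𝔥 →L[ℂ] 𝔥 => reTrace 𝔥 (M * X) :=
    (reTraceCLM 𝔥).continuous.comp (continuous_const.mul continuous_id)
  have h1 := ((hc.tendsto _).comp (Tendsto.operator_apply hF hlim')).div ((hc.tendsto _).comp hlim')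
    (hpos 0).ne'
  refine h1.congr fun t => ?_
  have h2 : reTrace 𝔥 (M * slope F 0 t (Q t)) = slope ν 0 t * reTrace 𝔥 (M * Q t) := by
    have h3 : slope F 0 t (Q t) = (t - 0)⁻¹ • (F t (Q t) - F 0 (Q t)) := rfl
    rw [h3, mul_smul_comm, reTrace_smul, mul_sub, reTrace_sub, hMe, hQe, mul_smul_comm,
      reTrace_smul, slope_def_field]
    ring
  simp only [Function.comp, Pi.div_apply]
  rw [h2, mul_div_cancel_right₀ _ (hpos t).ne']

end Perturbation

/-! ### Dependence of the deformed maps and of `log λ_u` on `u` -/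

namespace OpenQuantumRandomWalk

variable {d : ℕ} {𝔥 : Type*} [NormedAddCommGroup 𝔥] [InnerProductSpace ℂ 𝔥] [CompleteSpace 𝔥]
  [FiniteDimensional ℂ 𝔥] {W : OpenQuantumRandomWalk d 𝔥}

theorem deformedMap_eq_tsum (W : OpenQuantumRandomWalk d 𝔥) (u : EuclideanSpace ℝ (Fin d)) :
    W.deformedMap u = ∑' s : W.S,
      Real.exp ⟪u, ((s : W.V) : EuclideanSpace ℝ (Fin d))⟫_ℝ •
        ContinuousLinearMap.mulLeftRight ℂ (𝔥 →L[ℂ] 𝔥) (W.L s) (star (W.L s)) := by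
  refine tsum_congr fun s => ?_
  ext1 X
  have h : ((Real.exp (⟪u, ((s : W.V) : EuclideanSpace ℝ (Fin d))⟫_ℝ / 2) : ℝ) : ℂ) *
      ((Real.exp (⟪u, ((s : W.V) : EuclideanSpace ℝ (Fin d))⟫_ℝ / 2) : ℝ) : ℂ) =
      ((Real.exp ⟪u, ((s : W.V) : EuclideanSpace ℝ (Fin d))⟫_ℝ : ℝ) : ℂ) := by
    rw [← Complex.ofReal_mul, ← Real.exp_add, add_halves]
  change W.deformedL u s * X * star (W.deformedL u s) =
    Real.exp ⟪u, ((s : W.V) : EuclideanSpace ℝ (Fin d))⟫_ℝ • (W.L s * X * star (W.L s))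
  rw [deformedL, star_smul, smul_mul_assoc, smul_mul_assoc, mul_smul_comm, smul_smul,
    Complex.star_def, Complex.conj_ofReal, h, Complex.coe_smul]

theorem Deformable.summable_exp (hW : W.Deformable) (u : EuclideanSpace ℝ (Fin d)) :
    Summable fun s : W.S =>
      Real.exp ⟪u, ((s : W.V) : EuclideanSpace ℝ (Fin d))⟫_ℝ * ‖W.L s‖ ^ 2 := by
  have : FiniteDimensional ℝ (𝔥 →L[ℂ] 𝔥) := FiniteDimensional.trans ℝ ℂ (𝔥 →L[ℂ] 𝔥)
  refine (summable_norm_iff.2 (hW u)).congr fun s => ?_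
  rw [CStarRing.norm_star_mul_self, deformedL, norm_smul, Complex.norm_real,
    Real.norm_of_nonneg (Real.exp_pos _).le]
  calc _ = (Real.exp (⟪u, ((s : W.V) : EuclideanSpace ℝ (Fin d))⟫_ℝ / 2) *
        Real.exp (⟪u, ((s : W.V) : EuclideanSpace ℝ (Fin d))⟫_ℝ / 2)) * ‖W.L s‖ ^ 2 := by ring
    _ = _ := by rw [← Real.exp_add, add_halves]

theorem norm_mulLeftRight_star_le (A : 𝔥 →L[ℂ] 𝔥) :
    ‖ContinuousLinearMap.mulLeftRight ℂ (𝔥 →L[ℂ] 𝔥) A (star A)‖ ≤ ‖A‖ ^ 2 := by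
  refine (ContinuousLinearMap.opNorm_mulLeftRight_apply_apply_le _ _ _ _).trans ?_
  rw [norm_star, sq]

/-- The `v σ` are the sign vectors in `{±1}^d`, for which `max_σ ⟨v σ, x⟩` is the `ℓ¹` norm of `x`.
They dominate the exponential weights on a whole unit ball of parameters by finitely many weights.
-/
theorem exists_sign_inner_le (d : ℕ) : ∃ v : (Fin d → Bool) → EuclideanSpace ℝ (Fin d),
    ∀ w x : EuclideanSpace ℝ (Fin d), ‖w‖ ≤ 1 → ∃ σ, ⟪w, x⟫_ℝ ≤ ⟪v σ, x⟫_ℝ := by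
  refine ⟨fun σ => WithLp.toLp 2 fun i => if σ i then 1 else -1, fun w x hw =>
    ⟨fun i => decide (0 ≤ x i), ?_⟩⟩
  rw [PiLp.inner_apply, PiLp.inner_apply]
  refine Finset.sum_le_sum fun i _ => ?_
  have h1 : |w i| ≤ 1 := (PiLp.norm_apply_le w i).trans hw
  have h2 := abs_le.1 h1
  simp only [RCLike.inner_apply, conj_trivial, decide_eq_true_eq]
  split_ifs with h
  · nlinarith
  · nlinarith

theorem Deformable.continuous_deformedMap (hW : W.Deformable) : Continuous W.deformedMap := by
  obtain ⟨v, hv⟩ := exists_sign_inner_le d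
  simp only [funext W.deformedMap_eq_tsum]
  refine continuous_iff_continuousAt.2 fun u => ?_
  refine ContinuousOn.continuousAt (s := Metric.closedBall u 1) ?_
    (Metric.closedBall_mem_nhds u one_pos)
  refine continuousOn_tsum (u := fun s : W.S => ∑ σ,
    Real.exp ⟪u + v σ, ((s : W.V) : EuclideanSpace ℝ (Fin d))⟫_ℝ * ‖W.L s‖ ^ 2)
    (fun s => by fun_prop) (summable_sum fun σ _ => hW.summable_exp _) fun s w hw => ?_
  obtain ⟨σ, hσ⟩ := hv (w - u) ((s : W.V) : EuclideanSpace ℝ (Fin d))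
    (by rwa [← dist_eq_norm])
  rw [norm_smul, Real.norm_of_nonneg (Real.exp_pos _).le]
  refine le_trans ?_ (Finset.single_le_sum (f := fun σ =>
    Real.exp ⟪u + v σ, ((s : W.V) : EuclideanSpace ℝ (Fin d))⟫_ℝ * ‖W.L s‖ ^ 2)
    (fun σ _ => by positivity) (Finset.mem_univ σ))
  refine mul_le_mul (Real.exp_le_exp.2 ?_) (norm_mulLeftRight_star_le _) (norm_nonneg _)
    (Real.exp_pos _).le
  rw [inner_sub_left] at hσ
  rw [inner_add_left]
  linarith

theorem Deformable.exists_hasDerivAt_deformedMap (hW : W.Deformable)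
    (u e : EuclideanSpace ℝ (Fin d)) :
    ∃ D, HasDerivAt (fun t : ℝ => W.deformedMap (u + t • e)) D 0 := by
  let T : W.S → (𝔥 →L[ℂ] 𝔥) →L[ℂ] (𝔥 →L[ℂ] 𝔥) := fun s =>
    ContinuousLinearMap.mulLeftRight ℂ (𝔥 →L[ℂ] 𝔥) (W.L s) (star (W.L s))
  let a : W.S → ℝ := fun s => ⟪u, ((s : W.V) : EuclideanSpace ℝ (Fin d))⟫_ℝ
  let b : W.S → ℝ := fun s => ⟪e, ((s : W.V) : EuclideanSpace ℝ (Fin d))⟫_ℝ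
  have hT : ∀ s, ‖T s‖ ≤ ‖W.L s‖ ^ 2 := fun s => norm_mulLeftRight_star_le _
  have hsum : ∀ c : ℝ, Summable fun s => Real.exp (a s + c * b s) * ‖W.L s‖ ^ 2 := fun c => by
    refine (hW.summable_exp (u + c • e)).congr fun s => ?_
    rw [inner_add_left, real_inner_smul_left]
  have e1 : (fun t : ℝ => W.deformedMap (u + t • e)) =
      fun t => ∑' s, Real.exp (a s + t * b s) • T s := by
    funext t
    rw [deformedMap_eq_tsum]
    refine tsum_congr fun s => ?_
    rw [inner_add_left, real_inner_smul_left]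
  rw [e1]
  -- For `|t| < 1` the differentiated weight obeys `exp (a + t b) |b| ≤ exp (a + 2|b|)`, which is at
  -- most the sum of the weights at `t = 2` and `t = -2`. This is the summable majorant.
  refine ⟨_, hasDerivAt_tsum_of_isPreconnected
    (g := fun s t => Real.exp (a s + t * b s) • T s)
    (g' := fun s t => (Real.exp (a s + t * b s) * b s) • T s)
    ((hsum 2).add (hsum (-2))) Metric.isOpen_ball
    (convex_ball (0 : ℝ) 1).isPreconnected (fun s t _ => ?_) (fun s t ht => ?_)
    (Metric.mem_ball_self one_pos) ?_ (Metric.mem_ball_self one_pos)⟩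
  · have h1 : HasDerivAt (fun t : ℝ => a s + t * b s) (b s) t := by
      simpa using ((hasDerivAt_id t).mul_const (b s)).const_add (a s)
    exact h1.exp.smul_const (T s)
  · rw [norm_smul, Real.norm_eq_abs, abs_mul, Real.abs_exp, ← add_mul]
    refine mul_le_mul ?_ (hT s) (norm_nonneg _) (by positivity)
    have ht' : |t| ≤ 1 := by simpa using (mem_ball_zero_iff.1 ht).le
    have h1 : t * b s ≤ |b s| := by
      calc t * b s ≤ |t * b s| := le_abs_self _
        _ = |t| * |b s| := abs_mul _ _
        _ ≤ 1 * |b s| := by gcongr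
        _ = _ := one_mul _
    have h2 : |b s| ≤ Real.exp |b s| := by linarith [Real.add_one_le_exp |b s|]
    calc Real.exp (a s + t * b s) * |b s| ≤ Real.exp (a s + |b s|) * Real.exp |b s| := by gcongr
      _ = Real.exp (a s + 2 * |b s|) := by rw [← Real.exp_add]; ring_nf
      _ ≤ _ := by
        rcases abs_cases (b s) with h | h
        · rw [h.1]; exact le_add_of_nonneg_right (Real.exp_pos _).le
        · rw [h.1, mul_neg, ← neg_mul]; exact le_add_of_nonneg_left (Real.exp_pos _).le
  · refine Summable.of_norm_bounded (hsum 0) fun s => ?_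
    rw [norm_smul, Real.norm_of_nonneg (Real.exp_pos _).le]
    exact mul_le_mul_of_nonneg_left (hT s) (Real.exp_pos _).le

theorem isIrreducibleFamily_deformedL (hirr : IsIrreducibleMap W.auxMap)
    (u : EuclideanSpace ℝ (Fin d)) : IsIrreducibleFamily (W.deformedL u) :=
  (isIrreducibleFamily_of_isIrreducibleMap W.stochastic.summable hirr).smul fun s => by
    exact_mod_cast (Real.exp_pos _).ne'

theorem exists_L_ne_zero [Nontrivial 𝔥] (W : OpenQuantumRandomWalk d 𝔥) : ∃ s, W.L s ≠ 0 := by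
  by_contra! h
  have := W.stochastic
  simp only [h, mul_zero] at this
  exact one_ne_zero (this.unique hasSum_zero)

/-- The cumulant generating function `u ↦ log λ_u`. -/
noncomputable def logEigenvalue (W : OpenQuantumRandomWalk d 𝔥) (u : EuclideanSpace ℝ (Fin d)) : ℝ :=
  Real.log (spectralRadius ℂ (W.deformedMap u)).toReal

/-- Here the spectral radius is shown to be finite and positive, so the `toReal` and `Real.log` in
`logEigenvalue` lose nothing. -/
theorem exists_perron [Nontrivial 𝔥] (hW : W.Deformable) (hirr : IsIrreducibleMap W.auxMap)
    (u : EuclideanSpace ℝ (Fin d)) :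
    ∃ R M : 𝔥 →L[ℂ] 𝔥,
      spectralRadius ℂ (W.deformedMap u) = ENNReal.ofReal (Real.exp (W.logEigenvalue u)) ∧
      IsStrictlyPositive R ∧ ‖R‖ = 1 ∧ W.deformedMap u R = Real.exp (W.logEigenvalue u) • R ∧
      IsStrictlyPositive M ∧
      krausMap (fun s => star (W.deformedL u s)) M = Real.exp (W.logEigenvalue u) • M := by
  obtain ⟨s, hs⟩ := W.exists_L_ne_zero
  have hne : W.deformedL u s ≠ 0 := smul_ne_zero (by exact_mod_cast (Real.exp_pos _).ne') hs
  obtain ⟨μ, R, M, hμ, hr, h⟩ := krausMap_perronFrobenius (hW u)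
    (isIrreducibleFamily_deformedL hirr u) ⟨s, hne⟩
  have hexp : Real.exp (W.logEigenvalue u) = μ := by
    rw [logEigenvalue, deformedMap, hr, ENNReal.toReal_ofReal hμ.le, Real.exp_log hμ]
  rw [hexp]
  exact ⟨R, M, hr, h⟩

theorem continuous_logEigenvalue_and_hasDerivAt [Nontrivial 𝔥] (hW : W.Deformable)
    (hirr : IsIrreducibleMap W.auxMap) : Continuous W.logEigenvalue ∧
    ∀ u e, ∃ m, HasDerivAt (fun t : ℝ => W.logEigenvalue (u + t • e)) m 0 := by
  choose R M hr hR hR1 hRe hM hMe using exists_perron hW hirr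
  have hdual : ∀ u X, reTrace 𝔥 (M u * W.deformedMap u X) =
      Real.exp (W.logEigenvalue u) * reTrace 𝔥 (M u * X) := fun u X => by
    rw [deformedMap, reTrace_mul_krausMap (hW u), hMe, smul_mul_assoc, reTrace_smul]
  have hlim : ∀ u, Tendsto (fun w => Real.exp (W.logEigenvalue w)) (𝓝 u)
      (𝓝 (Real.exp (W.logEigenvalue u))) ∧ Tendsto R (𝓝 u) (𝓝 (R u)) := fun u =>
    tendsto_perron_eigenvalue (hW.continuous_deformedMap.tendsto u)
      (fun _ => (Real.exp_pos _).le) (fun w => (hR w).nonneg) hR1 hRe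
      (exists_pow_isStrictlyPositive (hW u) (isIrreducibleFamily_deformedL hirr u))
      (Real.exp_pos _).le (hR u).nonneg (hR1 u) (hRe u) (hM u) (hdual u)
  refine ⟨continuous_iff_continuousAt.2 fun u => ?_, fun u e => ?_⟩
  · have := (hlim u).1.log (Real.exp_pos _).ne'
    simp only [Real.log_exp] at this
    exact this
  · obtain ⟨D, hD⟩ := hW.exists_hasDerivAt_deformedMap u e
    have hc : Tendsto (fun t : ℝ => u + t • e) (𝓝 0) (𝓝 (u + (0 : ℝ) • e)) :=
      Continuous.tendsto (by fun_prop) 0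
    have h1 := hasDerivAt_perron_eigenvalue hD (hM (u + (0 : ℝ) • e))
      (ν := fun t => Real.exp (W.logEigenvalue (u + t • e))) (Q := fun t => R (u + t • e))
      (fun t => (hR _).nonneg) (fun t => hR1 _) (fun t => hRe _)
      ((hlim _).2.comp hc) (hdual _)
    have h2 := h1.log (Real.exp_pos _).ne'
    simp only [Real.log_exp] at h2
    exact ⟨_, h2⟩

end OpenQuantumRandomWalk

/-! ### The Gärtner–Ellis theorem for a differentiable cumulant generating function -/

section ExponentialRates

theorem log_ofReal_mul_exp_div {K : ℝ} (hK : 0 < K) (a : ℝ) (p : ℕ) (hp : p ≠ 0) :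
    ENNReal.log (ENNReal.ofReal (K * Real.exp (p * a))) / (p : EReal) =
      ((Real.log K / p + a : ℝ) : EReal) := by
  have hp' : (p : ℝ) ≠ 0 := Nat.cast_ne_zero.2 hp
  rw [ENNReal.log_ofReal_of_pos (by positivity), Real.log_mul hK.ne' (Real.exp_pos _).ne',
    Real.log_exp, show ((p : ℕ) : EReal) = ((p : ℝ) : EReal) from rfl, ← EReal.coe_div]
  congr 1
  field_simp

theorem tendsto_log_ofReal_mul_exp_div {K : ℝ} (hK : 0 < K) (a : ℝ) :
    Tendsto (fun p : ℕ => ENNReal.log (ENNReal.ofReal (K * Real.exp (p * a))) / (p : EReal))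
      atTop (𝓝 (a : EReal)) := by
  have h1 : Tendsto (fun p : ℕ => Real.log K / (p : ℝ) + a) atTop (𝓝 a) := by
    simpa using (tendsto_const_div_atTop_nhds_zero_nat (Real.log K)).add_const a
  refine ((continuous_coe_real_ereal.tendsto a).comp h1).congr' ?_
  filter_upwards [eventually_ne_atTop 0] with p hp
  exact (log_ofReal_mul_exp_div hK a p hp).symm

theorem log_div_natCast_mono {x y : ℝ≥0∞} (h : x ≤ y) (p : ℕ) :
    ENNReal.log x / (p : EReal) ≤ ENNReal.log y / (p : EReal) :=
  EReal.div_le_div_right_of_nonneg p.cast_nonneg' (ENNReal.log_monotone h)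

theorem limsup_log_div_le {m : ℕ → ℝ≥0∞} {K a : ℝ} (hK : 0 < K)
    (h : ∀ᶠ p : ℕ in atTop, m p ≤ ENNReal.ofReal (K * Real.exp (p * a))) :
    limsup (fun p : ℕ => ENNReal.log (m p) / (p : EReal)) atTop ≤ a := by
  rw [← (tendsto_log_ofReal_mul_exp_div hK a).limsup_eq]
  exact limsup_le_limsup (h.mono fun p hp => log_div_natCast_mono hp p)

theorem le_liminf_log_div {m : ℕ → ℝ≥0∞} {K a : ℝ} (hK : 0 < K)
    (h : ∀ᶠ p : ℕ in atTop, ENNReal.ofReal (K * Real.exp (p * a)) ≤ m p) :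
    a ≤ liminf (fun p : ℕ => ENNReal.log (m p) / (p : EReal)) atTop := by
  rw [← (tendsto_log_ofReal_mul_exp_div hK a).liminf_eq]
  exact liminf_le_liminf (h.mono fun p hp => log_div_natCast_mono hp p)

end ExponentialRates

/-! ### Large deviation bounds from two-sided exponential moment estimates -/

section GartnerEllis

variable {d : ℕ} {Λ : EuclideanSpace ℝ (Fin d) → ℝ}
  {μ : ℕ → Measure (EuclideanSpace ℝ (Fin d))}

/-- The vectors `± e_i` of the standard basis. -/
noncomputable def signedBasis (d : ℕ) : Fin d ⊕ Fin d → EuclideanSpace ℝ (Fin d) :=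
  Sum.elim (fun i => EuclideanSpace.single i 1) fun i => -EuclideanSpace.single i 1

theorem isCompact_forall_inner_signedBasis_le (c : Fin d ⊕ Fin d → ℝ) :
    IsCompact {x : EuclideanSpace ℝ (Fin d) | ∀ j, ⟪signedBasis d j, x⟫_ℝ ≤ c j} := by
  have h1 : IsCompact (EuclideanSpace.equiv (Fin d) ℝ ⁻¹'
      Set.pi Set.univ fun i => Set.Icc (-c (Sum.inr i)) (c (Sum.inl i))) :=
    (EuclideanSpace.equiv (Fin d) ℝ).toHomeomorph.isCompact_preimage.2
      (isCompact_univ_pi fun i => isCompact_Icc)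
  convert h1 using 1
  ext x
  simp only [signedBasis, Set.mem_ofPred_eq, Sum.forall, Sum.elim_inl, Sum.elim_inr,
    inner_neg_left, EuclideanSpace.inner_single_left, map_one, one_mul, Set.mem_preimage,
    Set.mem_pi, Set.mem_univ, true_implies, Set.mem_Icc, PiLp.coe_continuousLinearEquiv]
  constructor
  · exact fun h i => ⟨by linarith [h.2 i], h.1 i⟩
  · exact fun h => ⟨fun i => (h i).2, fun i => by linarith [(h i).1]⟩

/-- For small `t > 0` the slope of `g` is still below `c`. With `g t = Λ (u + t v)`, this makes
half-spaces beyond the gradient exponentially negligible under the tilt by `u`. -/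
theorem exists_pos_sub_mul_lt {g : ℝ → ℝ} {m c : ℝ} (hg : HasDerivAt g m 0) (hc : m < c) :
    ∃ t : ℝ, 0 ≤ t ∧ g t - t * c < g 0 := by
  have h1 := (hasDerivAt_iff_tendsto_slope.1 hg).mono_left
    (nhdsWithin_mono 0 fun t (ht : t ∈ Set.Ioi (0 : ℝ)) => ne_of_gt ht)
  obtain ⟨t, ht, ht0⟩ := ((h1.eventually_lt_const hc).and self_mem_nhdsWithin).exists
  have ht0' : (0 : ℝ) < t := ht0
  refine ⟨t, ht0'.le, ?_⟩
  rw [slope_def_field, sub_zero, div_lt_iff₀ ht0'] at ht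
  linarith

/-- Chernoff's bound for the tilted measure: on the half-space, `1 ≤ exp (p t (⟨v, y⟩ - c))`. -/
theorem setLIntegral_exp_inner_le {p : ℕ} {u v : EuclideanSpace ℝ (Fin d)} {c t C : ℝ}
    (ht : 0 ≤ t) (hup : ∫⁻ y, ENNReal.ofReal (Real.exp (p * ⟪u + t • v, y⟫_ℝ)) ∂(μ p) ≤
      ENNReal.ofReal (C * Real.exp (p * Λ (u + t • v)))) :
    ∫⁻ y in {y | c ≤ ⟪v, y⟫_ℝ}, ENNReal.ofReal (Real.exp (p * ⟪u, y⟫_ℝ)) ∂(μ p) ≤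
      ENNReal.ofReal (C * Real.exp (p * (Λ (u + t • v) - t * c))) := by
  have hm : MeasurableSet {y : EuclideanSpace ℝ (Fin d) | c ≤ ⟪v, y⟫_ℝ} :=
    (isClosed_le continuous_const (by fun_prop)).measurableSet
  calc ∫⁻ y in {y | c ≤ ⟪v, y⟫_ℝ}, ENNReal.ofReal (Real.exp (p * ⟪u, y⟫_ℝ)) ∂(μ p)
      ≤ ∫⁻ y in {y | c ≤ ⟪v, y⟫_ℝ}, ENNReal.ofReal (Real.exp (-(p * (t * c)))) *
          ENNReal.ofReal (Real.exp (p * ⟪u + t • v, y⟫_ℝ)) ∂(μ p) := by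
        refine setLIntegral_mono' hm fun y hy => ?_
        rw [← ENNReal.ofReal_mul (Real.exp_pos _).le, ← Real.exp_add]
        refine ENNReal.ofReal_le_ofReal (Real.exp_le_exp.2 ?_)
        rw [inner_add_left, real_inner_smul_left]
        have : 0 ≤ (p : ℝ) * (t * (⟪v, y⟫_ℝ - c)) :=
          mul_nonneg (Nat.cast_nonneg p) (mul_nonneg ht (sub_nonneg.2 hy))
        linarith
    _ ≤ ENNReal.ofReal (Real.exp (-(p * (t * c)))) *
          ∫⁻ y, ENNReal.ofReal (Real.exp (p * ⟪u + t • v, y⟫_ℝ)) ∂(μ p) := by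
        rw [lintegral_const_mul _ (by fun_prop)]
        gcongr
        exact Measure.restrict_le_self
    _ ≤ ENNReal.ofReal (Real.exp (-(p * (t * c)))) *
          ENNReal.ofReal (C * Real.exp (p * Λ (u + t • v))) := by gcongr
    _ = _ := by
        rw [← ENNReal.ofReal_mul (Real.exp_pos _).le, mul_left_comm, ← Real.exp_add]
        ring_nf

theorem measure_halfSpace_le {p : ℕ} {v : EuclideanSpace ℝ (Fin d)} {c C : ℝ}
    (hup : ∫⁻ y, ENNReal.ofReal (Real.exp (p * ⟪v, y⟫_ℝ)) ∂(μ p) ≤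
      ENNReal.ofReal (C * Real.exp (p * Λ v))) :
    μ p {y | c ≤ ⟪v, y⟫_ℝ} ≤ ENNReal.ofReal (C * Real.exp (p * (Λ v - c))) := by
  have := setLIntegral_exp_inner_le (Λ := Λ) (μ := μ) (u := 0) (c := c) zero_le_one
    (by simpa using hup)
  simpa using this

/-- Each half-space `{Λ u + a ≤ ⟨u, y⟩}` has probability at most `C exp (-p a)`. The half-spaces for
`± e_i` cover everything outside a compact box, so exponential tightness is built in, and
compactness leaves finitely many inside the box. -/
theorem limsup_log_measure_div_le
    (hup : ∀ u, ∃ C : ℝ, 0 < C ∧ ∀ p : ℕ,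
      ∫⁻ y, ENNReal.ofReal (Real.exp (p * ⟪u, y⟫_ℝ)) ∂(μ p) ≤
        ENNReal.ofReal (C * Real.exp (p * Λ u)))
    {F : Set (EuclideanSpace ℝ (Fin d))} (hF : IsClosed F) {a : ℝ}
    (ha : ∀ x ∈ F, ∃ u, a < ⟪u, x⟫_ℝ - Λ u) :
    limsup (fun p : ℕ => ENNReal.log (μ p F) / (p : EReal)) atTop ≤ ((-a : ℝ) : EReal) := by
  classical
  choose C hC hCup using hup
  have hK : IsCompact (F ∩ {x | ∀ j, ⟪signedBasis d j, x⟫_ℝ ≤ a + Λ (signedBasis d j)}) :=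
    (isCompact_forall_inner_signedBasis_le _).inter_left hF
  obtain ⟨T, hT⟩ := hK.elim_finite_subcover (fun u => {y | a < ⟪u, y⟫_ℝ - Λ u})
    (fun u => isOpen_lt continuous_const (by fun_prop))
    (fun x hx => Set.mem_iUnion.2 (ha x hx.1))
  let T' := T ∪ Finset.univ.image (signedBasis d)
  have hcov : F ⊆ ⋃ u ∈ T', {y | Λ u + a ≤ ⟪u, y⟫_ℝ} := fun x hx => by
    by_cases h : ∀ j, ⟪signedBasis d j, x⟫_ℝ ≤ a + Λ (signedBasis d j)
    · obtain ⟨u, hu, hxu⟩ := Set.mem_iUnion₂.1 (hT ⟨hx, h⟩)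
      refine Set.mem_iUnion₂.2 ⟨u, Finset.mem_union_left _ hu, ?_⟩
      have hxu' : a < ⟪u, x⟫_ℝ - Λ u := hxu
      change Λ u + a ≤ ⟪u, x⟫_ℝ
      linarith
    · push Not at h
      obtain ⟨j, hj⟩ := h
      refine Set.mem_iUnion₂.2 ⟨signedBasis d j, Finset.mem_union_right _
        (Finset.mem_image_of_mem _ (Finset.mem_univ j)), ?_⟩
      change Λ (signedBasis d j) + a ≤ ⟪signedBasis d j, x⟫_ℝ
      linarith
  have hS : 0 ≤ ∑ u ∈ T', C u := Finset.sum_nonneg fun u _ => (hC u).le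
  -- The `+ 1` keeps the constant positive even if `T'` is empty.
  refine limsup_log_div_le (K := ∑ u ∈ T', C u + 1) (by positivity)
    (Eventually.of_forall fun p => ?_)
  calc μ p F ≤ μ p (⋃ u ∈ T', {y | Λ u + a ≤ ⟪u, y⟫_ℝ}) := measure_mono hcov
    _ ≤ ∑ u ∈ T', μ p {y | Λ u + a ≤ ⟪u, y⟫_ℝ} := measure_biUnion_finset_le _ _
    _ ≤ ∑ u ∈ T', ENNReal.ofReal (C u * Real.exp (p * -a)) := by
        refine Finset.sum_le_sum fun u _ => (measure_halfSpace_le (hCup u p)).trans_eq ?_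
        rw [sub_add_cancel_left]
    _ = ENNReal.ofReal ((∑ u ∈ T', C u) * Real.exp (p * -a)) := by
        rw [Finset.sum_mul, ENNReal.ofReal_sum_of_nonneg fun u _ =>
          mul_nonneg (hC u).le (Real.exp_pos _).le]
    _ ≤ _ := ENNReal.ofReal_le_ofReal
        (mul_le_mul_of_nonneg_right (by linarith) (Real.exp_pos _).le)

/-- The mass tilted by `u` is at least `k exp (p Λ u)`, while by `hv` each half-space `{c j ≤ ⟨v j,
y⟩}` carries exponentially less. Eventually at least `k / 2 · exp (p Λ u)` lies in their common
complement, where the density is at most `exp (p b)`. -/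
theorem exists_le_measure_of_halfSpaces {ι : Type*} [Fintype ι] [∀ p, IsProbabilityMeasure (μ p)]
    (hlow : ∀ u, ∃ c : ℝ, 0 < c ∧ ∀ p : ℕ, ENNReal.ofReal (c * Real.exp (p * Λ u)) ≤
      ∫⁻ y, ENNReal.ofReal (Real.exp (p * ⟪u, y⟫_ℝ)) ∂(μ p))
    (hup : ∀ u, ∃ C : ℝ, 0 < C ∧ ∀ p : ℕ,
      ∫⁻ y, ENNReal.ofReal (Real.exp (p * ⟪u, y⟫_ℝ)) ∂(μ p) ≤
        ENNReal.ofReal (C * Real.exp (p * Λ u)))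
    {u : EuclideanSpace ℝ (Fin d)} {v : ι → EuclideanSpace ℝ (Fin d)} {c : ι → ℝ}
    (hv : ∀ j, ∃ t : ℝ, 0 ≤ t ∧ Λ (u + t • v j) - t * c j < Λ u) {b : ℝ}
    {G : Set (EuclideanSpace ℝ (Fin d))}
    (hG : ∀ y, (∀ j, ⟪v j, y⟫_ℝ < c j) → y ∈ G ∧ ⟪u, y⟫_ℝ ≤ b) :
    ∃ K : ℝ, 0 < K ∧ ∀ᶠ p : ℕ in atTop,
      ENNReal.ofReal (K * Real.exp (p * (Λ u - b))) ≤ μ p G := by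
  classical
  choose C hC hCup using hup
  choose t ht htlt using hv
  obtain ⟨k, hk, hklow⟩ := hlow u
  let N : Set (EuclideanSpace ℝ (Fin d)) := {y | ∀ j, ⟪v j, y⟫_ℝ < c j}
  have hcov : Set.univ ⊆ N ∪ ⋃ j, {y | c j ≤ ⟪v j, y⟫_ℝ} := by
    intro y _
    by_cases h : y ∈ N
    · exact Or.inl h
    · have h' : ¬ ∀ j, ⟪v j, y⟫_ℝ < c j := h
      push Not at h'
      obtain ⟨j, hj⟩ := h'
      exact Or.inr (Set.mem_iUnion.2 ⟨j, hj⟩)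
  have hN : MeasurableSet N := by
    have : N = ⋂ j, {y | ⟪v j, y⟫_ℝ < c j} := by ext; simp [N]
    rw [this]
    exact MeasurableSet.iInter fun j =>
      (isOpen_lt (by fun_prop) continuous_const).measurableSet
  have hlim : Tendsto (fun p : ℕ => ∑ j, C (u + t j • v j) *
      Real.exp (p * (Λ (u + t j • v j) - t j * c j - Λ u))) atTop (𝓝 0) := by
    rw [← Finset.sum_const_zero (s := (Finset.univ : Finset ι))]
    refine tendsto_finsetSum _ fun j _ => ?_
    rw [← mul_zero (C (u + t j • v j))]
    refine Tendsto.const_mul _ (Real.tendsto_exp_atBot.comp ?_)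
    exact tendsto_natCast_atTop_atTop.atTop_mul_const_of_neg (sub_neg.2 (htlt j))
  refine ⟨k / 2, by positivity, ?_⟩
  filter_upwards [hlim.eventually_le_const (half_pos hk)] with p hp
  have hbound : ENNReal.ofReal (k * Real.exp (p * Λ u)) ≤
      ENNReal.ofReal (Real.exp (p * b) * (μ p G).toReal + ∑ j, C (u + t j • v j) *
        Real.exp (p * (Λ (u + t j • v j) - t j * c j))) := by
    calc ENNReal.ofReal (k * Real.exp (p * Λ u))
        ≤ ∫⁻ y in Set.univ, ENNReal.ofReal (Real.exp (p * ⟪u, y⟫_ℝ)) ∂(μ p) := by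
          rw [setLIntegral_univ]; exact hklow p
      _ ≤ ∫⁻ y in N ∪ ⋃ j, {y | c j ≤ ⟪v j, y⟫_ℝ},
            ENNReal.ofReal (Real.exp (p * ⟪u, y⟫_ℝ)) ∂(μ p) := lintegral_mono_set hcov
      _ ≤ ∫⁻ y in N, ENNReal.ofReal (Real.exp (p * ⟪u, y⟫_ℝ)) ∂(μ p) +
            ∑ j, ∫⁻ y in {y | c j ≤ ⟪v j, y⟫_ℝ},
              ENNReal.ofReal (Real.exp (p * ⟪u, y⟫_ℝ)) ∂(μ p) := by
          refine (lintegral_union_le _ _ _).trans (add_le_add le_rfl ?_)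
          exact (lintegral_iUnion_le _ _).trans_eq (tsum_fintype _)
      _ ≤ ENNReal.ofReal (Real.exp (p * b)) * μ p G + ∑ j, ENNReal.ofReal
            (C (u + t j • v j) * Real.exp (p * (Λ (u + t j • v j) - t j * c j))) := by
          refine add_le_add ?_ (Finset.sum_le_sum fun j _ =>
            setLIntegral_exp_inner_le (ht j) (hCup _ p))
          calc _ ≤ ∫⁻ y in N, ENNReal.ofReal (Real.exp (p * b)) ∂(μ p) := by
                refine setLIntegral_mono' hN fun y hy => ENNReal.ofReal_le_ofReal
                  (Real.exp_le_exp.2 (mul_le_mul_of_nonneg_left (hG y hy).2 (Nat.cast_nonneg p)))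
            _ = ENNReal.ofReal (Real.exp (p * b)) * μ p N := setLIntegral_const _ _
            _ ≤ _ := by
                gcongr
                exact fun y hy => (hG y hy).1
      _ = _ := by
          rw [ENNReal.ofReal_add (by positivity) (Finset.sum_nonneg fun j _ =>
            mul_nonneg (hC _).le (Real.exp_pos _).le), ENNReal.ofReal_mul (Real.exp_pos _).le,
            ENNReal.ofReal_toReal (measure_ne_top _ _), ENNReal.ofReal_sum_of_nonneg fun j _ =>
            mul_nonneg (hC _).le (Real.exp_pos _).le]
  have hS : 0 ≤ ∑ j, C (u + t j • v j) * Real.exp (p * (Λ (u + t j • v j) - t j * c j)) :=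
    Finset.sum_nonneg fun j _ => mul_nonneg (hC _).le (Real.exp_pos _).le
  rw [ENNReal.ofReal_le_ofReal_iff (by positivity)] at hbound
  have hsum : ∑ j, C (u + t j • v j) * Real.exp (p * (Λ (u + t j • v j) - t j * c j)) ≤
      k / 2 * Real.exp (p * Λ u) := by
    refine le_trans (le_of_eq ?_) (mul_le_mul_of_nonneg_right hp (Real.exp_pos _).le)
    rw [Finset.sum_mul]
    refine Finset.sum_congr rfl fun j _ => ?_
    rw [mul_assoc, ← Real.exp_add]
    ring_nf
  rw [ENNReal.ofReal_le_iff_le_toReal (measure_ne_top _ _)]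
  have h1 : k / 2 * Real.exp (p * Λ u) ≤ Real.exp (p * b) * (μ p G).toReal := by linarith
  calc k / 2 * Real.exp (p * (Λ u - b)) = k / 2 * Real.exp (p * Λ u) * Real.exp (-(p * b)) := by
        rw [mul_assoc, ← Real.exp_add]; ring_nf
    _ ≤ Real.exp (p * b) * (μ p G).toReal * Real.exp (-(p * b)) := by gcongr
    _ = (μ p G).toReal := by
        rw [mul_right_comm, ← Real.exp_add, add_neg_cancel, Real.exp_zero, one_mul]

/-- A law of large numbers under the tilt by `u`: the mass concentrates near the gradient `x`, since
`2d` coordinate half-spaces cover the complement of a small box around `x` and all are negligible.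
-/
theorem le_liminf_log_measure_div_of_hasDerivAt [∀ p, IsProbabilityMeasure (μ p)]
    (hlow : ∀ u, ∃ c : ℝ, 0 < c ∧ ∀ p : ℕ, ENNReal.ofReal (c * Real.exp (p * Λ u)) ≤
      ∫⁻ y, ENNReal.ofReal (Real.exp (p * ⟪u, y⟫_ℝ)) ∂(μ p))
    (hup : ∀ u, ∃ C : ℝ, 0 < C ∧ ∀ p : ℕ,
      ∫⁻ y, ENNReal.ofReal (Real.exp (p * ⟪u, y⟫_ℝ)) ∂(μ p) ≤
        ENNReal.ofReal (C * Real.exp (p * Λ u)))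
    {u x : EuclideanSpace ℝ (Fin d)}
    (hx : ∀ i, HasDerivAt (fun t : ℝ => Λ (u + t • EuclideanSpace.single i 1)) (x i) 0)
    {G : Set (EuclideanSpace ℝ (Fin d))} (hG : IsOpen G) (hxG : x ∈ G) :
    ((Λ u - ⟪u, x⟫_ℝ : ℝ) : EReal) ≤
      liminf (fun p : ℕ => ENNReal.log (μ p G) / (p : EReal)) atTop := by
  refine EReal.ge_of_forall_gt_iff_ge.1 fun z hz => ?_
  have hz' : z < Λ u - ⟪u, x⟫_ℝ := EReal.coe_lt_coe_iff.1 hz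
  have hopen : IsOpen (G ∩ {y | ⟪u, y⟫_ℝ < Λ u - z}) :=
    hG.inter (isOpen_lt (by fun_prop) continuous_const)
  obtain ⟨δ, hδ, hball⟩ : ∃ δ : ℝ, 0 < δ ∧ ∀ y : EuclideanSpace ℝ (Fin d),
      (∀ i, |y i - x i| < δ) → y ∈ G ∩ {y | ⟪u, y⟫_ℝ < Λ u - z} := by
    have h1 : IsOpen ((EuclideanSpace.equiv (Fin d) ℝ).symm ⁻¹'
        (G ∩ {y | ⟪u, y⟫_ℝ < Λ u - z})) :=
      hopen.preimage (EuclideanSpace.equiv (Fin d) ℝ).symm.continuous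
    obtain ⟨δ, hδ, hb⟩ := Metric.isOpen_iff.1 h1 (EuclideanSpace.equiv (Fin d) ℝ x) (by
      simp only [Set.mem_preimage, ContinuousLinearEquiv.symm_apply_apply]
      exact ⟨hxG, by change ⟪u, x⟫_ℝ < _; linarith⟩)
    refine ⟨δ, hδ, fun y hy => ?_⟩
    have h2 := hb (a := EuclideanSpace.equiv (Fin d) ℝ y) (by
      rw [Metric.mem_ball, dist_pi_lt_iff hδ]
      exact hy)
    simpa only [Set.mem_preimage, ContinuousLinearEquiv.symm_apply_apply] using h2
  obtain ⟨K, hK, h⟩ := exists_le_measure_of_halfSpaces (G := G) (b := Λ u - z) hlow hup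
    (u := u) (v := signedBasis d) (c := Sum.elim (fun i => x i + δ) fun i => -x i + δ)
    (fun j => by
      rcases j with i | i
      · simpa [signedBasis] using exists_pos_sub_mul_lt (hx i) (lt_add_of_pos_right _ hδ)
      · have h1 : HasDerivAt (fun t : ℝ => Λ (u + t • -EuclideanSpace.single i 1)) (-x i) 0 := by
          have h2 := HasDerivAt.scomp (0 : ℝ) (h := fun t : ℝ => -t)
            (by simpa using hx i) (hasDerivAt_neg (0 : ℝ))
          simpa [Function.comp_def] using h2
        simpa [signedBasis] using exists_pos_sub_mul_lt h1 (lt_add_of_pos_right _ hδ))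
    (fun y hy => by
      have hy' := hball y fun i => by
        have h1 := hy (Sum.inl i)
        have h2 := hy (Sum.inr i)
        simp only [signedBasis, Sum.elim_inl, Sum.elim_inr, inner_neg_left,
          EuclideanSpace.inner_single_left, map_one, one_mul] at h1 h2
        rw [abs_lt]
        constructor <;> linarith
      exact ⟨hy'.1, (show ⟪u, y⟫_ℝ < Λ u - z from hy'.2).le⟩)
  refine le_liminf_log_div hK (h.mono fun p hp => ?_)
  rwa [sub_sub_cancel] at hp

/-- A point with finite rate is approximated by gradients of `Λ`, without increasing the rate. -/
theorem exists_gradient_near (hc : Continuous Λ) (h0 : Λ 0 = 0)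
    (hd : ∀ u e, ∃ m, HasDerivAt (fun t : ℝ => Λ (u + t • e)) m 0)
    {x : EuclideanSpace ℝ (Fin d)} {r : ℝ} (hr : ∀ u, ⟪u, x⟫_ℝ - Λ u ≤ r) {η : ℝ} (hη : 0 < η) :
    ∃ u y : EuclideanSpace ℝ (Fin d), dist y x < η ∧
      (∀ i, HasDerivAt (fun t : ℝ => Λ (u + t • EuclideanSpace.single i 1)) (y i) 0) ∧
      ⟪u, y⟫_ℝ - Λ u ≤ r := by
  have hr0 : 0 ≤ r := by simpa [h0] using hr 0
  -- At the maximiser `u` below, `ε ‖u‖ ^ 2 ≤ 2 r`, so the displacement `ε • u` has squared norm at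
  -- most `2 ε r`.
  obtain ⟨ε, hε, hεη⟩ : ∃ ε : ℝ, 0 < ε ∧ 2 * ε * r < η ^ 2 := by
    refine ⟨η ^ 2 / (2 * (r + 1)), by positivity, ?_⟩
    have : 2 * (η ^ 2 / (2 * (r + 1))) * r = η ^ 2 * (r / (r + 1)) := by field_simp
    rw [this]
    refine mul_lt_of_lt_one_right (by positivity) ?_
    rw [div_lt_one (by positivity)]
    linarith
  -- The penalty ensures that a maximum is attained: outside radius `√(2 r / ε)` it exceeds `r`, so
  -- `f ≤ 0 = f 0` there. Criticality at `u` says that the gradient of `Λ` is `x - ε • u`.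
  let f : EuclideanSpace ℝ (Fin d) → ℝ := fun u => ⟪u, x⟫_ℝ - Λ u - ε / 2 * ‖u‖ ^ 2
  have hfc : Continuous f := by fun_prop
  have hf0 : f 0 = 0 := by simp [f, h0]
  obtain ⟨u, hu, hmax⟩ := (isCompact_closedBall (0 : EuclideanSpace ℝ (Fin d))
    (√(2 * r / ε))).exists_isMaxOn ⟨0, by simp⟩ hfc.continuousOn
  have hfu : 0 ≤ f u := hf0 ▸ hmax (Metric.mem_closedBall_self (Real.sqrt_nonneg _))
  have hglob : ∀ w, f w ≤ f u := fun w => by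
    by_cases hw : w ∈ Metric.closedBall (0 : EuclideanSpace ℝ (Fin d)) (√(2 * r / ε))
    · exact hmax hw
    · refine le_trans ?_ hfu
      rw [mem_closedBall_zero_iff, not_le] at hw
      have h1 := (Real.sqrt_lt' ((Real.sqrt_nonneg _).trans_lt hw)).1 hw
      rw [div_lt_iff₀ hε] at h1
      have h2 := hr w
      change ⟪w, x⟫_ℝ - Λ w - ε / 2 * ‖w‖ ^ 2 ≤ 0
      linarith
  have hfu' : 0 ≤ ⟪u, x⟫_ℝ - Λ u - ε / 2 * ‖u‖ ^ 2 := hfu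
  refine ⟨u, x - ε • u, ?_, fun i => ?_, ?_⟩
  · rw [dist_eq_norm, sub_sub_cancel_left, norm_neg, norm_smul, Real.norm_of_nonneg hε.le]
    refine lt_of_pow_lt_pow_left₀ 2 hη.le ?_
    have h1 := hr u
    have h2 : ε * ‖u‖ ^ 2 ≤ 2 * r := by linarith
    calc (ε * ‖u‖) ^ 2 = ε * (ε * ‖u‖ ^ 2) := by ring
      _ ≤ ε * (2 * r) := by gcongr
      _ < η ^ 2 := by linarith
  · obtain ⟨m, hm⟩ := hd u (EuclideanSpace.single i 1)
    have hq : HasDerivAt (fun t : ℝ => f (u + t • EuclideanSpace.single i 1))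
        (x i - m - ε * u i) 0 := by
      have h1 : (fun t : ℝ => f (u + t • EuclideanSpace.single i 1)) = fun t : ℝ =>
          ⟪u, x⟫_ℝ + t * x i - Λ (u + t • EuclideanSpace.single i 1) -
            ε / 2 * (‖u‖ ^ 2 + 2 * (t * u i) + t ^ 2) := by
        funext t
        simp only [f]
        rw [norm_add_sq_real, inner_add_left, real_inner_smul_left, real_inner_smul_right,
          norm_smul, mul_pow, EuclideanSpace.inner_single_left, EuclideanSpace.inner_single_right]
        simp
      rw [h1]
      have h2 : HasDerivAt (fun t : ℝ => ⟪u, x⟫_ℝ + t * x i) (x i) 0 := by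
        simpa using ((hasDerivAt_id (0 : ℝ)).mul_const (x i)).const_add ⟪u, x⟫_ℝ
      have h3 : HasDerivAt (fun t : ℝ => ε / 2 * (‖u‖ ^ 2 + 2 * (t * u i) + t ^ 2))
          (ε * u i) 0 := by
        have h4 := ((((hasDerivAt_id (0 : ℝ)).mul_const (u i)).const_mul 2).const_add
          (‖u‖ ^ 2)).add (hasDerivAt_pow 2 (0 : ℝ))
        refine (h4.const_mul (ε / 2)).congr_deriv ?_
        simp
        ring
      exact (h2.sub hm).sub h3
    have hloc : IsLocalMax (fun t : ℝ => f (u + t • EuclideanSpace.single i 1)) 0 :=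
      Eventually.of_forall fun t => by simpa using hglob (u + t • EuclideanSpace.single i 1)
    have hz := hloc.hasDerivAt_eq_zero hq
    have hmi : (x - ε • u) i = m := by
      simp only [PiLp.sub_apply, PiLp.smul_apply, smul_eq_mul]
      linarith
    rw [hmi]
    exact hm
  · rw [inner_sub_right, real_inner_smul_right, real_inner_self_eq_norm_sq]
    have h1 := hr u
    have h2 : 0 ≤ ε * ‖u‖ ^ 2 := by positivity
    linarith

/-- At `u = 0` the moment equals `1` for every `p`, so neither exponential growth nor decay is
compatible with the bounds. -/
theorem cgf_zero [∀ p, IsProbabilityMeasure (μ p)]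
    (hlow : ∀ u, ∃ c : ℝ, 0 < c ∧ ∀ p : ℕ, ENNReal.ofReal (c * Real.exp (p * Λ u)) ≤
      ∫⁻ y, ENNReal.ofReal (Real.exp (p * ⟪u, y⟫_ℝ)) ∂(μ p))
    (hup : ∀ u, ∃ C : ℝ, 0 < C ∧ ∀ p : ℕ,
      ∫⁻ y, ENNReal.ofReal (Real.exp (p * ⟪u, y⟫_ℝ)) ∂(μ p) ≤
        ENNReal.ofReal (C * Real.exp (p * Λ u))) : Λ 0 = 0 := by
  obtain ⟨c, hc, h1⟩ := hlow 0
  obtain ⟨C, hC, h2⟩ := hup 0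
  simp only [inner_zero_left, mul_zero, Real.exp_zero, ENNReal.ofReal_one, lintegral_one,
    measure_univ] at h1 h2
  have h3 := le_liminf_log_div hc (Eventually.of_forall h1)
  have h4 := limsup_log_div_le hC (Eventually.of_forall h2)
  simp only [ENNReal.log_one, EReal.zero_div, liminf_const, limsup_const] at h3 h4
  exact le_antisymm (by exact_mod_cast h3) (by exact_mod_cast h4)

/-- The Legendre transform of a finite function, with values in the extended reals. -/
noncomputable def legendre (Λ : EuclideanSpace ℝ (Fin d) → ℝ) (x : EuclideanSpace ℝ (Fin d)) :
    EReal :=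
  ⨆ u, ((⟪u, x⟫_ℝ - Λ u : ℝ) : EReal)

/-- Testing against `u = 0` gives nonnegativity, and testing against `± e_i` puts each level set in
a compact box. -/
theorem isGoodRateFunction_legendre (h0 : Λ 0 = 0) : IsGoodRateFunction (legendre Λ) := by
  have hlsc : LowerSemicontinuous (legendre Λ) :=
    lowerSemicontinuous_iSup fun u =>
      (continuous_coe_real_ereal.comp (by fun_prop)).lowerSemicontinuous
  refine ⟨fun x => ?_, hlsc, fun α => ?_⟩
  · refine le_trans ?_ (le_iSup (fun u => ((⟪u, x⟫_ℝ - Λ u : ℝ) : EReal)) 0)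
    simp [h0]
  · refine (isCompact_forall_inner_signedBasis_le
      fun j => α + Λ (signedBasis d j)).of_isClosed_subset
      (hlsc.isClosed_preimage α) fun x hx j => ?_
    have h1 := (le_iSup (fun u => ((⟪u, x⟫_ℝ - Λ u : ℝ) : EReal)) (signedBasis d j)).trans hx
    have h2 := EReal.coe_le_coe_iff.1 h1
    linarith

theorem satisfiesLDP_legendre [∀ p, IsProbabilityMeasure (μ p)] (hc : Continuous Λ)
    (hd : ∀ u e, ∃ m, HasDerivAt (fun t : ℝ => Λ (u + t • e)) m 0)
    (hlow : ∀ u, ∃ c : ℝ, 0 < c ∧ ∀ p : ℕ, ENNReal.ofReal (c * Real.exp (p * Λ u)) ≤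
      ∫⁻ y, ENNReal.ofReal (Real.exp (p * ⟪u, y⟫_ℝ)) ∂(μ p))
    (hup : ∀ u, ∃ C : ℝ, 0 < C ∧ ∀ p : ℕ,
      ∫⁻ y, ENNReal.ofReal (Real.exp (p * ⟪u, y⟫_ℝ)) ∂(μ p) ≤
        ENNReal.ofReal (C * Real.exp (p * Λ u))) :
    SatisfiesLDP (fun p A => μ p A) (legendre Λ) := by
  intro G F hG hF hGF
  refine ⟨?_, ?_, ?_⟩
  · rw [EReal.neg_le]
    refine le_iInf₂ fun x hx => EReal.le_of_forall_lt_iff_le.1 fun r hr => ?_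
    have hr' : ∀ u, ⟪u, x⟫_ℝ - Λ u ≤ r := fun u => EReal.coe_le_coe_iff.1
      ((le_iSup (fun u => ((⟪u, x⟫_ℝ - Λ u : ℝ) : EReal)) u).trans hr.le)
    obtain ⟨η, hη, hball⟩ := Metric.isOpen_iff.1 hG x hx
    obtain ⟨u, y, hy, hder, hle⟩ := exists_gradient_near hc (cgf_zero hlow hup) hd hr' hη
    have h1 := le_liminf_log_measure_div_of_hasDerivAt hlow hup hder hG (hball hy)
    rw [EReal.neg_le]
    refine le_trans ?_ h1
    rw [← EReal.coe_neg, EReal.coe_le_coe_iff]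
    linarith
  · exact (liminf_le_limsup).trans (limsup_le_limsup (Eventually.of_forall fun p =>
      log_div_natCast_mono (measure_mono hGF) p))
  · refine EReal.le_of_forall_lt_iff_le.1 fun z hz => ?_
    rw [EReal.neg_lt_comm] at hz
    have h1 := limsup_log_measure_div_le hup hF (a := -z) fun x hx => by
      have h2 : ((-z : ℝ) : EReal) < legendre Λ x := by
        rw [EReal.coe_neg]
        exact hz.trans_le (iInf₂_le x hx)
      obtain ⟨u, hu⟩ := lt_iSup_iff.1 h2
      exact ⟨u, EReal.coe_lt_coe_iff.1 hu⟩
    rwa [neg_neg] at h1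

end GartnerEllis

namespace OpenQuantumRandomWalk

/-! ### Exponential moments of the position process -/

variable {d : ℕ} {𝔥 : Type*} [NormedAddCommGroup 𝔥] [InnerProductSpace ℂ 𝔥] [CompleteSpace 𝔥]
  [FiniteDimensional ℂ 𝔥] {W : OpenQuantumRandomWalk d 𝔥}

/-- The path of length `p` with the given positions, constant after time `p`. -/
def extendPath {V : Type*} {p : ℕ} (x : Fin (p + 1) → V) (k : ℕ) : V :=
  x ⟨min k p, by omega⟩

theorem extendPath_snoc_of_le {V : Type*} {p : ℕ} (y : Fin (p + 1) → V) (v : V) {k : ℕ}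
    (hk : k ≤ p) : extendPath (Fin.snoc (α := fun _ => V) y v) k = extendPath y k := by
  have h1 : (⟨min k (p + 1), by omega⟩ : Fin (p + 1 + 1)) =
      Fin.castSucc ⟨min k p, by omega⟩ := by
    ext
    simp only [Fin.castSucc_mk]
    omega
  rw [extendPath, h1, Fin.snoc_castSucc, extendPath]

theorem extendPath_snoc_last {V : Type*} {p : ℕ} (y : Fin (p + 1) → V) (v : V) :
    extendPath (Fin.snoc (α := fun _ => V) y v) (p + 1) = v := by
  have h1 : (⟨min (p + 1) (p + 1), by omega⟩ : Fin (p + 1 + 1)) = Fin.last (p + 1) := by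
    ext
    simp
  rw [extendPath, h1, Fin.snoc_last]

/-- A function of the first `p + 1` positions lives on a countable space whose points correspond to
cylinders, and the law is prescribed on these. -/
theorem lintegral_pathLaw (W : OpenQuantumRandomWalk d 𝔥) (ρ : W.DiagonalState) (p : ℕ)
    (h : (ℕ → W.V) → ℝ≥0∞) (hh : ∀ x y, (∀ k ≤ p, x k = y k) → h x = h y) :
    ∫⁻ ω, h ω ∂(W.pathLaw ρ) = ∑' x : Fin (p + 1) → W.V, h (extendPath x) *
      ENNReal.ofReal (reTrace 𝔥 (W.pathState ρ (extendPath x) p)) := by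
  let r : (ℕ → W.V) → Fin (p + 1) → W.V := fun ω i => ω i
  have hr : Measurable r := measurable_pi_lambda _ fun i => measurable_pi_apply _
  have hext : ∀ ω : ℕ → W.V, ∀ k ≤ p, extendPath (r ω) k = ω k := fun ω k hk => by
    simp [extendPath, r, hk]
  calc ∫⁻ ω, h ω ∂(W.pathLaw ρ) = ∫⁻ ω, h (extendPath (r ω)) ∂(W.pathLaw ρ) :=
        lintegral_congr fun ω => hh _ _ fun k hk => (hext ω k hk).symm
    _ = ∫⁻ x, h (extendPath x) ∂((W.pathLaw ρ).map r) :=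
        (lintegral_map (f := fun x => h (extendPath x)) (measurable_of_countable _) hr).symm
    _ = _ := by
        rw [lintegral_countable']
        refine tsum_congr fun x => ?_
        rw [Measure.map_apply hr (measurableSet_singleton x), ← (W.pathLaw_spec ρ).2]
        congr 2
        ext ω
        simp only [Set.mem_preimage, Set.mem_singleton_iff, Set.mem_ofPred_eq]
        constructor
        · rintro rfl k hk
          exact (hext ω k hk).symm
        · intro H
          funext i
          have h1 := H i (Nat.lt_succ_iff.1 i.2)
          have h2 : extendPath x i = x i := by
            rw [extendPath]
            congr 1
            ext
            exact min_eq_left (Nat.lt_succ_iff.1 i.2)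
          rw [h2] at h1
          exact h1

/-- The sum over the paths of length `p` of `exp ⟨u, x p - x 0⟩ Tr (B ρ_x)`, where `ρ_x` is the
state at the end of the path `x`. -/
noncomputable def pathSum (W : OpenQuantumRandomWalk d 𝔥) (ρ : W.DiagonalState)
    (u : EuclideanSpace ℝ (Fin d)) (p : ℕ) (B : 𝔥 →L[ℂ] 𝔥) : ℝ≥0∞ :=
  ∑' x : Fin (p + 1) → W.V, ENNReal.ofReal
    (Real.exp ⟪u, ((extendPath x p : W.V) : EuclideanSpace ℝ (Fin d)) -
      ((extendPath x 0 : W.V) : EuclideanSpace ℝ (Fin d))⟫_ℝ *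
      reTrace 𝔥 (B * W.pathState ρ (extendPath x) p))

theorem pathSum_mono (ρ : W.DiagonalState) (u : EuclideanSpace ℝ (Fin d)) (p : ℕ)
    {B C : 𝔥 →L[ℂ] 𝔥} (h : B ≤ C) : W.pathSum ρ u p B ≤ W.pathSum ρ u p C :=
  ENNReal.tsum_le_tsum fun x => ENNReal.ofReal_le_ofReal (mul_le_mul_of_nonneg_left
    (reTrace_mul_le_mul h ((ContinuousLinearMap.nonneg_iff_isPositive _).2
      (W.pathState_isPositive ρ _ p))) (Real.exp_pos _).le)

theorem pathSum_smul (ρ : W.DiagonalState) (u : EuclideanSpace ℝ (Fin d)) (p : ℕ)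
    {c : ℝ} (hc : 0 ≤ c) (B : 𝔥 →L[ℂ] 𝔥) :
    W.pathSum ρ u p (c • B) = ENNReal.ofReal c * W.pathSum ρ u p B := by
  rw [pathSum, pathSum, ← ENNReal.tsum_mul_left]
  refine tsum_congr fun x => ?_
  rw [← ENNReal.ofReal_mul hc, smul_mul_assoc, reTrace_smul, mul_left_comm]

theorem hasSum_exp_step (hW : W.Deformable) (u : EuclideanSpace ℝ (Fin d)) (B : 𝔥 →L[ℂ] 𝔥) :
    HasSum (fun v : W.V => Real.exp ⟪u, (v : EuclideanSpace ℝ (Fin d))⟫_ℝ •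
      (star (W.step v) * B * W.step v)) (krausMap (fun s => star (W.deformedL u s)) B) := by
  have h1 := krausMap_apply _ (summable_mul_star (hW u)) B
  refine (Subtype.val_injective.hasSum_iff ?_).1 (h1.congr_fun fun s => ?_)
  · intro v hv
    have : v ∉ W.S := fun h => hv ⟨⟨v, h⟩, rfl⟩
    simp [step, this]
  · have h : ((Real.exp (⟪u, ((s : W.V) : EuclideanSpace ℝ (Fin d))⟫_ℝ / 2) : ℝ) : ℂ) *
        ((Real.exp (⟪u, ((s : W.V) : EuclideanSpace ℝ (Fin d))⟫_ℝ / 2) : ℝ) : ℂ) =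
        ((Real.exp ⟪u, ((s : W.V) : EuclideanSpace ℝ (Fin d))⟫_ℝ : ℝ) : ℂ) := by
      rw [← Complex.ofReal_mul, ← Real.exp_add, add_halves]
    simp only [Function.comp, step, s.2, dite_true, Subtype.coe_eta]
    rw [star_star, deformedL, star_smul, smul_mul_assoc, smul_mul_assoc, mul_smul_comm, smul_smul,
      Complex.star_def, Complex.conj_ofReal, h, Complex.coe_smul]

/-- Splitting off the last position and using cyclicity of the trace, the sum over the last step
acts on the observable `B` alone, as the dual deformed map. -/
theorem pathSum_succ (hW : W.Deformable) (ρ : W.DiagonalState) (u : EuclideanSpace ℝ (Fin d))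
    (p : ℕ) {B : 𝔥 →L[ℂ] 𝔥} (hB : 0 ≤ B) :
    W.pathSum ρ u (p + 1) B =
      W.pathSum ρ u p (krausMap (fun s => star (W.deformedL u s)) B) := by
  rw [pathSum, ← (Fin.snocEquiv fun _ : Fin (p + 1 + 1) => W.V).tsum_eq, ENNReal.tsum_prod',
    ENNReal.tsum_comm, pathSum]
  refine tsum_congr fun y => ?_
  set σ := W.pathState ρ (extendPath y) p with hσ
  have hσpos : 0 ≤ σ := (ContinuousLinearMap.nonneg_iff_isPositive _).2
    (W.pathState_isPositive ρ _ p)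
  have h1 := (((((Equiv.subRight (extendPath y p)).hasSum_iff.2 (W.hasSum_exp_step hW u B)).mul_right
    σ).mapL (reTraceCLM 𝔥)).mul_left
    (Real.exp ⟪u, ((extendPath y p : W.V) : EuclideanSpace ℝ (Fin d)) -
      ((extendPath y 0 : W.V) : EuclideanSpace ℝ (Fin d))⟫_ℝ))
  have h2 : ∀ v : W.V, Real.exp ⟪u, ((extendPath (Fin.snoc (α := fun _ => W.V) y v) (p + 1) : W.V) :
        EuclideanSpace ℝ (Fin d)) -
        ((extendPath (Fin.snoc (α := fun _ => W.V) y v) 0 : W.V) : EuclideanSpace ℝ (Fin d))⟫_ℝ *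
      reTrace 𝔥 (B * W.pathState ρ (extendPath (Fin.snoc (α := fun _ => W.V) y v)) (p + 1)) =
      Real.exp ⟪u, ((extendPath y p : W.V) : EuclideanSpace ℝ (Fin d)) -
      ((extendPath y 0 : W.V) : EuclideanSpace ℝ (Fin d))⟫_ℝ *
        reTrace 𝔥 (Real.exp ⟪u, ((v - extendPath y p : W.V) : EuclideanSpace ℝ (Fin d))⟫_ℝ •
          (star (W.step (v - extendPath y p)) * B * W.step (v - extendPath y p)) * σ) := by
    intro v
    have e1 : W.pathState ρ (extendPath (Fin.snoc (α := fun _ => W.V) y v)) (p + 1) =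
        W.step (v - extendPath y p) * σ * star (W.step (v - extendPath y p)) := by
      rw [pathState, extendPath_snoc_last, extendPath_snoc_of_le y v le_rfl,
        W.pathState_congr ρ p _ (extendPath y) fun k hk => extendPath_snoc_of_le y v hk]
    rw [e1, extendPath_snoc_last, extendPath_snoc_of_le y v (Nat.zero_le p), smul_mul_assoc,
      reTrace_smul, ← mul_assoc (Real.exp _), ← Real.exp_add, ← inner_add_right]
    congr 1
    · congr 2
      push_cast
      abel
    · rw [← mul_assoc, reTrace_mul_comm]
      simp only [mul_assoc]
  have h3 : ∀ v : W.V, 0 ≤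
      Real.exp ⟪u, ((extendPath (Fin.snoc (α := fun _ => W.V) y v) (p + 1) : W.V) :
        EuclideanSpace ℝ (Fin d)) -
        ((extendPath (Fin.snoc (α := fun _ => W.V) y v) 0 : W.V) : EuclideanSpace ℝ (Fin d))⟫_ℝ *
      reTrace 𝔥 (B * W.pathState ρ (extendPath (Fin.snoc (α := fun _ => W.V) y v)) (p + 1)) :=
    fun v => mul_nonneg (Real.exp_pos _).le (reTrace_mul_nonneg hB
      ((ContinuousLinearMap.nonneg_iff_isPositive _).2 (W.pathState_isPositive ρ _ _)))
  have h4 : HasSum (fun v : W.V =>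
      Real.exp ⟪u, ((extendPath (Fin.snoc (α := fun _ => W.V) y v) (p + 1) : W.V) :
        EuclideanSpace ℝ (Fin d)) -
        ((extendPath (Fin.snoc (α := fun _ => W.V) y v) 0 : W.V) : EuclideanSpace ℝ (Fin d))⟫_ℝ *
      reTrace 𝔥 (B * W.pathState ρ (extendPath (Fin.snoc (α := fun _ => W.V) y v)) (p + 1)))
      (Real.exp ⟪u, ((extendPath y p : W.V) : EuclideanSpace ℝ (Fin d)) -
      ((extendPath y 0 : W.V) : EuclideanSpace ℝ (Fin d))⟫_ℝ *
        reTrace 𝔥 (krausMap (fun s => star (W.deformedL u s)) B * σ)) :=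
    h1.congr_fun h2
  change ∑' v : W.V, ENNReal.ofReal _ = _
  rw [← h4.tsum_eq, ENNReal.ofReal_tsum_of_nonneg h3 h4.summable]
  rfl

theorem pathSum_zero_one (ρ : W.DiagonalState) (u : EuclideanSpace ℝ (Fin d)) :
    W.pathSum ρ u 0 1 = 1 := by
  rw [pathSum, ← (Equiv.funUnique (Fin 1) W.V).symm.tsum_eq]
  simp only [extendPath, sub_self, inner_zero_right, Real.exp_zero, one_mul, pathState]
  rw [← ENNReal.ofReal_one, ← ρ.trace_one.tsum_eq,
    ENNReal.ofReal_tsum_of_nonneg (fun i => reTrace_nonneg (ρ.isPositive i)) ρ.trace_one.summable]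
  rfl

/-- The sum with observable `M` is exactly geometric, and `a • M ≤ 1` together with `b • 1 ≤ M`
transfers this to the observable `1` up to constants. -/
theorem exists_pathSum_bounds (hW : W.Deformable) (ρ : W.DiagonalState)
    {u : EuclideanSpace ℝ (Fin d)} {M : 𝔥 →L[ℂ] 𝔥} {r : ℝ} (hM : IsStrictlyPositive M)
    (hMe : krausMap (fun s => star (W.deformedL u s)) M = Real.exp r • M) :
    (∃ c : ℝ, 0 < c ∧ ∀ p : ℕ,
      ENNReal.ofReal (c * Real.exp (p * r)) ≤ W.pathSum ρ u p 1) ∧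
    ∃ C : ℝ, 0 < C ∧ ∀ p : ℕ, W.pathSum ρ u p 1 ≤ ENNReal.ofReal (C * Real.exp (p * r)) := by
  obtain ⟨a, ha, haM⟩ := exists_smul_le_of_isStrictlyPositive
    (isStrictlyPositive_one (A := 𝔥 →L[ℂ] 𝔥)) hM.nonneg
  obtain ⟨b, hb, hbM⟩ := hM.exists_pos_smul_one_le
  have hpow : ∀ p : ℕ, W.pathSum ρ u p M =
      ENNReal.ofReal (Real.exp (p * r)) * W.pathSum ρ u 0 M := fun p => by
    induction p with
    | zero => simp
    | succ p ih =>
      rw [pathSum_succ hW ρ u p hM.nonneg, hMe, pathSum_smul ρ u p (Real.exp_pos _).le, ih,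
        ← mul_assoc, ← ENNReal.ofReal_mul (Real.exp_pos _).le, ← Real.exp_add]
      congr 3
      push_cast
      ring
  have h0 : ENNReal.ofReal b ≤ W.pathSum ρ u 0 M := by
    have := pathSum_mono ρ u 0 hbM
    rwa [pathSum_smul ρ u 0 hb.le, pathSum_zero_one, mul_one] at this
  have h1 : ENNReal.ofReal a * W.pathSum ρ u 0 M ≤ 1 := by
    have := pathSum_mono ρ u 0 haM
    rwa [pathSum_smul ρ u 0 ha.le, pathSum_zero_one] at this
  have ha' : ENNReal.ofReal a ≠ 0 := (ENNReal.ofReal_pos.2 ha).ne'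
  have hb' : ENNReal.ofReal b ≠ 0 := (ENNReal.ofReal_pos.2 hb).ne'
  refine ⟨⟨a * b, by positivity, fun p => ?_⟩, ⟨b⁻¹ * a⁻¹, by positivity, fun p => ?_⟩⟩
  · calc ENNReal.ofReal (a * b * Real.exp (p * r))
        = ENNReal.ofReal a * (ENNReal.ofReal (Real.exp (p * r)) * ENNReal.ofReal b) := by
          rw [← ENNReal.ofReal_mul (Real.exp_pos _).le, ← ENNReal.ofReal_mul ha.le]
          ring_nf
      _ ≤ ENNReal.ofReal a * W.pathSum ρ u p M := by rw [hpow]; gcongr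
      _ = W.pathSum ρ u p (a • M) := (pathSum_smul ρ u p ha.le M).symm
      _ ≤ W.pathSum ρ u p 1 := pathSum_mono ρ u p haM
  · have h2 : W.pathSum ρ u 0 M ≤ ENNReal.ofReal a⁻¹ := by
      rw [ENNReal.ofReal_inv_of_pos ha, ENNReal.le_inv_iff_mul_le, mul_comm]
      exact h1
    have h3 := pathSum_mono ρ u p hbM
    rw [pathSum_smul ρ u p hb.le, hpow] at h3
    calc W.pathSum ρ u p 1
        = ENNReal.ofReal b⁻¹ * (ENNReal.ofReal b * W.pathSum ρ u p 1) := by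
          rw [ENNReal.ofReal_inv_of_pos hb, ← mul_assoc,
            ENNReal.inv_mul_cancel hb' ENNReal.ofReal_ne_top, one_mul]
      _ ≤ ENNReal.ofReal b⁻¹ * (ENNReal.ofReal (Real.exp (p * r)) * ENNReal.ofReal a⁻¹) := by
          exact mul_le_mul_right (h3.trans (mul_le_mul_right h2 _)) _
      _ = _ := by
          rw [← ENNReal.ofReal_mul (Real.exp_pos _).le, ← ENNReal.ofReal_mul (by positivity)]
          ring_nf

/-- The law of the mean displacement `(X_p - X_0) / p`. -/
noncomputable def meanLaw (W : OpenQuantumRandomWalk d 𝔥) (ρ : W.DiagonalState) (p : ℕ) :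
    Measure (EuclideanSpace ℝ (Fin d)) :=
  (W.pathLaw ρ).map fun ω => (p : ℝ)⁻¹ •
    ((ω p : EuclideanSpace ℝ (Fin d)) - (ω 0 : EuclideanSpace ℝ (Fin d)))

theorem measurable_meanDisplacement (W : OpenQuantumRandomWalk d 𝔥) (p : ℕ) :
    Measurable fun ω : ℕ → W.V => (p : ℝ)⁻¹ •
      ((ω p : EuclideanSpace ℝ (Fin d)) - (ω 0 : EuclideanSpace ℝ (Fin d))) :=
  Measurable.const_smul (((measurable_subtype_coe (p := (· ∈ W.V))).comp (measurable_pi_apply p)).sub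
    ((measurable_subtype_coe (p := (· ∈ W.V))).comp (measurable_pi_apply 0))) (p : ℝ)⁻¹

instance (W : OpenQuantumRandomWalk d 𝔥) (ρ : W.DiagonalState) (p : ℕ) :
    IsProbabilityMeasure (W.meanLaw ρ p) :=
  have := (W.pathLaw_spec ρ).1
  Measure.isProbabilityMeasure_map (W.measurable_meanDisplacement p).aemeasurable

theorem meanProb_eq_meanLaw (ρ : W.DiagonalState) (p : ℕ) {A : Set (EuclideanSpace ℝ (Fin d))}
    (hA : MeasurableSet A) : W.meanProb ρ p A = W.meanLaw ρ p A :=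
  (Measure.map_apply (W.measurable_meanDisplacement p) hA).symm

theorem lintegral_exp_meanLaw (ρ : W.DiagonalState) (p : ℕ) (u : EuclideanSpace ℝ (Fin d)) :
    ∫⁻ y, ENNReal.ofReal (Real.exp (p * ⟪u, y⟫_ℝ)) ∂(W.meanLaw ρ p) = W.pathSum ρ u p 1 := by
  rw [meanLaw, lintegral_map (by fun_prop) (W.measurable_meanDisplacement p)]
  have h : ∀ ω : ℕ → W.V, (p : ℝ) * ⟪u, (p : ℝ)⁻¹ •
      ((ω p : EuclideanSpace ℝ (Fin d)) - (ω 0 : EuclideanSpace ℝ (Fin d)))⟫_ℝ =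
      ⟪u, (ω p : EuclideanSpace ℝ (Fin d)) - (ω 0 : EuclideanSpace ℝ (Fin d))⟫_ℝ := fun ω => by
    -- At `p = 0` both sides vanish: the left by the factor `p`, the right because the displacement
    -- is zero.
    rcases eq_or_ne p 0 with rfl | hp
    · simp
    · rw [real_inner_smul_right, mul_inv_cancel_left₀ (Nat.cast_ne_zero.2 hp)]
  simp only [h]
  rw [lintegral_pathLaw W ρ p _ fun x y hxy => by rw [hxy p le_rfl, hxy 0 (Nat.zero_le p)]]
  refine tsum_congr fun x => ?_
  rw [← ENNReal.ofReal_mul (Real.exp_pos _).le, one_mul]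

theorem rate_eq_legendre [Nontrivial 𝔥] (hW : W.Deformable) (hirr : IsIrreducibleMap W.auxMap) :
    W.rate = legendre W.logEigenvalue := by
  funext x
  unfold rate legendre
  refine iSup_congr fun u => ?_
  obtain ⟨R, M, hr, -⟩ := exists_perron hW hirr u
  rw [hr, ENNReal.log_ofReal_of_pos (Real.exp_pos _), Real.log_exp, EReal.coe_sub]

/-- On the zero space all traces vanish and cannot add up to one; this supplies the nontriviality
that Perron–Frobenius theory requires. -/
theorem DiagonalState.nontrivial (ρ : W.DiagonalState) : Nontrivial 𝔥 := by
  by_contra h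
  have hs : Subsingleton 𝔥 := not_nontrivial_iff_subsingleton.1 h
  have h0 : ∀ i, reTrace 𝔥 (ρ.block i) = 0 := fun i => by
    have : ρ.block i = 0 := ContinuousLinearMap.ext fun v => Subsingleton.elim _ _
    simp [this, reTrace]
  have h1 := ρ.trace_one
  simp only [h0] at h1
  exact one_ne_zero (h1.unique hasSum_zero)

end OpenQuantumRandomWalk

/-! ### The large deviation principle -/

theorem mainTheorem1 {d : ℕ} {𝔥 : Type*} [NormedAddCommGroup 𝔥] [InnerProductSpace ℂ 𝔥]
    [CompleteSpace 𝔥] [FiniteDimensional ℂ 𝔥] (W : OpenQuantumRandomWalk d 𝔥)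
    (hW : W.Deformable) (hirr : IsIrreducibleMap W.auxMap) (ρ : W.DiagonalState) :
    IsGoodRateFunction W.rate ∧ SatisfiesLDP (W.meanProb ρ) W.rate := by
  have : Nontrivial 𝔥 := ρ.nontrivial
  have hlow : ∀ u, ∃ c : ℝ, 0 < c ∧ ∀ p : ℕ,
      ENNReal.ofReal (c * Real.exp (p * W.logEigenvalue u)) ≤
        ∫⁻ y, ENNReal.ofReal (Real.exp (p * ⟪u, y⟫_ℝ)) ∂(W.meanLaw ρ p) := fun u => by
    simp only [OpenQuantumRandomWalk.lintegral_exp_meanLaw]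
    obtain ⟨R, M, -, -, -, -, hM, hMe⟩ := W.exists_perron hW hirr u
    exact (W.exists_pathSum_bounds hW ρ hM hMe).1
  have hup : ∀ u, ∃ C : ℝ, 0 < C ∧ ∀ p : ℕ,
      ∫⁻ y, ENNReal.ofReal (Real.exp (p * ⟪u, y⟫_ℝ)) ∂(W.meanLaw ρ p) ≤
        ENNReal.ofReal (C * Real.exp (p * W.logEigenvalue u)) := fun u => by
    simp only [OpenQuantumRandomWalk.lintegral_exp_meanLaw]
    obtain ⟨R, M, -, -, -, -, hM, hMe⟩ := W.exists_perron hW hirr u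
    exact (W.exists_pathSum_bounds hW ρ hM hMe).2
  obtain ⟨hc, hd⟩ := W.continuous_logEigenvalue_and_hasDerivAt hW hirr
  rw [OpenQuantumRandomWalk.rate_eq_legendre hW hirr]
  refine ⟨isGoodRateFunction_legendre (cgf_zero hlow hup), fun G F hG hF hGF => ?_⟩
  have := satisfiesLDP_legendre hc hd hlow hup G F hG hF hGF
  simpa only [OpenQuantumRandomWalk.meanProb_eq_meanLaw ρ _ hG.measurableSet,
    OpenQuantumRandomWalk.meanProb_eq_meanLaw ρ _ hF.measurableSet] using this
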